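/- Let $M$ be a two-sorted first-order $L$-structure with sorts $M_t$ (points) and $M_b$ (parameters), and let $\phi(x,y_1,\dots,y_k)$ be an $L$-formula such that the sets $\phi(M_t,\bar b)$, $\bar b\in M_b^k$, form a basis of a topology on $M_t$; equip $M_t$ with this topology and assume it is Hausdorff. "Definable" means definable in $M$ with parameters from both sorts. For definable $X\subseteq M_t$ let $d_M(X)$ be the largest $d<\omega$ such that $X$ is a union of $d$ pairwise disjoint non-empty definable subsets that are clopen in $X$ ($d_M(X)=\infty$ if there is no largest $d$). $X$ is definably connected if $d_M(X)=1$; a definably connected component of a definable set $Y$ is a definably connected definable subset of $Y$ that is clopen in $Y$. For closed definable $X\subseteq M_t$ the relation $D_M(X)\ge\alpha$ ($\alpha$ an ordinal) is defined by: $D_M(X)\ge 0$ if $X\ne\emptyset$; $D_M(X)\ge\delta$ for a limit $\delta$ if $D_M(X)\ge\alpha$ for all $\alpha<\delta$; $D_M(X)\ge\alpha+1$ if there is a closed definable $Y\subseteq X$ with empty interior in $X$ and $D_M(Y)\ge\alpha$. Write $D_M(X)=\alpha$ if $D_M(X)\ge\alpha$ but not $D_M(X)\ge\alpha+1$, and $D_M(X)=\infty$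 if $D_M(X)\ge\alpha$ for all $\alpha$. $(M,\phi)$ is t.t.t. (topologically totally transcendental) if every definable subset of $M_t$ is a boolean combination of definable open sets, $D_M(X)\ne\infty$ for every closed definable $X\subseteq M_t$, and $d_M(X)<\infty$ for every definable $X\subseteq M_t$. It is 1-dimensional if $D_M(M_t)=1$. Theorem. Let $(M,\phi)$ be a 1-dimensional $\omega$-saturated t.t.t. structure such that $M_t$ is definably connected and $d_M(M_t\setminus\{x\})\ge 2$ for every $x\in M_t$. Then there is a finite set $X\subseteq M_t$ such that $M_t\setminus X$ has finitely many definably connected components, is their union, and each of them, $C$, is o-minimal: there is a definable dense linear order without endpoints on $C$, inducing the topology of $C$, such that every definable subset of $C$ is a finite union of points and open intervals with endpoints in $C\cup\{\pm\infty\}$. -/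

import Mathlib

namespace TTT

universe u v w w'

/-!
Two-sorted structures. A structure with a sort `Mt` of points and a sort `Mb` of parameters is given
by an `L`-structure on the disjoint union `Mt ⊕ Mb` in which the sort `Mt` (hence also `Mb`) is
definable without parameters; the latter is a field of `IsTopStructure` below.
-/

/-- The structure is `ω`-saturated: every set of formulas in one variable (of either sort) over
finitely many parameters that is finitely satisfiable in the structure is realized in it. -/
def IsOmegaSaturated (L : FirstOrder.Language.{w, w'}) (M : Type u) [L.Structure M] : Prop :=
  ∀ (n : ℕ) (a : Fin n → M) (p : Set (L.Formula (Fin n ⊕ Unit))),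
    (∀ q ⊆ p, q.Finite → ∃ x : M, ∀ ψ ∈ q, ψ.Realize (Sum.elim a (fun _ => x))) →
      ∃ x : M, ∀ ψ ∈ p, ψ.Realize (Sum.elim a (fun _ => x))

section Defs

variable (L : FirstOrder.Language.{w, w'}) {Mt : Type u} (Mb : Type v) [L.Structure (Mt ⊕ Mb)]

/-- A set of points is definable, with arbitrary parameters from both sorts. -/
def Dfn (X : Set Mt) : Prop :=
  (Set.univ : Set (Mt ⊕ Mb)).Definable₁ L (Sum.inl '' X)

/-- `basicSet L Mb φ b` is the set `φ(Mt, b)` of points `x` satisfying `φ(x, b₁, …, b_k)`. -/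
def basicSet {k : ℕ} (φ : L.Formula (Unit ⊕ Fin k)) (b : Fin k → Mb) : Set Mt :=
  {x | φ.Realize (Sum.elim (fun _ => (Sum.inl x : Mt ⊕ Mb)) (fun i => Sum.inr (b i)))}

variable [TopologicalSpace Mt]

/-- `(M, φ)` is a first order topological structure, and the topology on `Mt` is the one generated
by the basis `{φ(Mt, b) | b ∈ Mb ^ k}`. -/
structure IsTopStructure {k : ℕ} (φ : L.Formula (Unit ⊕ Fin k)) : Prop where
  sort_definable :
    (∅ : Set (Mt ⊕ Mb)).Definable₁ L (Set.range (Sum.inl : Mt → Mt ⊕ Mb))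
  isTopologicalBasis : TopologicalSpace.IsTopologicalBasis (Set.range (basicSet (Mt := Mt) L Mb φ))

/-- Condition (A): every definable set of points is a boolean combination of definable open sets. -/
def ConditionA : Prop :=
  ∀ X : Set Mt, Dfn L Mb X →
    X ∈ BooleanSubalgebra.closure {U : Set Mt | IsOpen U ∧ Dfn L Mb U}

/-- `DimGE L Mb α X` is the relation `D_M(X) ≥ α`. -/
inductive DimGE : Ordinal.{u} → Set Mt → Prop
  | zero {X : Set Mt} : X.Nonempty → DimGE 0 X
  | limit {X : Set Mt} {δ : Ordinal.{u}} :
      Order.IsSuccLimit δ → (∀ α < δ, DimGE α X) → DimGE δ X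
  | succ {X Y : Set Mt} {α : Ordinal.{u}} :
      IsClosed Y → Dfn L Mb Y → Y ⊆ X →
        interior ((Subtype.val : X → Mt) ⁻¹' Y) = ∅ → DimGE α Y → DimGE (Order.succ α) X

/-- `D_M(X) = α`. -/
def DimEq (α : Ordinal.{u}) (X : Set Mt) : Prop :=
  DimGE L Mb α X ∧ ¬ DimGE L Mb (Order.succ α) X

/-- `D_M(X) ≠ ∞` for all closed definable sets of points `X`. -/
def HasDimension : Prop :=
  ∀ X : Set Mt, IsClosed X → Dfn L Mb X → ∃ α : Ordinal.{u}, ¬ DimGE L Mb α X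

/-- `X` is the union of `d` pairwise disjoint nonempty definable subsets that are clopen in `X`. -/
def HasClopenPartition (X : Set Mt) (d : ℕ) : Prop :=
  ∃ f : Fin d → Set Mt,
    (∀ i, (f i).Nonempty ∧ Dfn L Mb (f i) ∧ IsClopen ((Subtype.val : X → Mt) ⁻¹' (f i))) ∧
    Pairwise (fun i j => Disjoint (f i) (f j)) ∧ ⋃ i, f i = X

/-- `d_M(X)`, the number of definably connected components of `X`: the maximal `d` such that `X`
has a partition into `d` nonempty definable subsets clopen in `X`, and `∞` if there is none. -/
noncomputable def numComponents (X : Set Mt) : ℕ∞ :=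
  ⨆ d : {d : ℕ // HasClopenPartition L Mb X d}, ((d : ℕ) : ℕ∞)

/-- `X` is (nonempty and) definably connected. -/
def DefConnected (X : Set Mt) : Prop := numComponents L Mb X = 1

/-- `C` is a definably connected component of `Y`. -/
def IsDefComponent (C Y : Set Mt) : Prop :=
  C ⊆ Y ∧ Dfn L Mb C ∧ IsClopen ((Subtype.val : Y → Mt) ⁻¹' C) ∧ DefConnected L Mb C

/-- `(M, φ)` is topologically totally transcendental (with the standing assumption that `Mt` is
Hausdorff). -/
structure IsTTT {k : ℕ} (φ : L.Formula (Unit ⊕ Fin k)) : Prop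
    extends IsTopStructure (Mt := Mt) L Mb φ where
  t2 : T2Space Mt
  conditionA : ConditionA (Mt := Mt) L Mb
  hasDimension : HasDimension (Mt := Mt) L Mb
  numComponents_lt_top : ∀ X : Set Mt, Dfn L Mb X → numComponents L Mb X < ⊤

/-- `S` is a point or an open interval with endpoints in `D ∪ {±∞}`. -/
def IsPointOrInterval {D : Type u} [LinearOrder D] (S : Set D) : Prop :=
  (∃ a, S = {a}) ∨ (∃ a b, S = Set.Ioo a b) ∨ (∃ a, S = Set.Iio a) ∨ (∃ a, S = Set.Ioi a) ∨
    S = Set.univ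

/-- The set of points `D`, with the structure and the topology induced from `M`, is o-minimal: there
is a definable dense linear order without endpoints on `D` that induces the topology of `D` and
for which every definable subset of `D` is a finite union of points and open intervals with
endpoints in `D ∪ {±∞}`. -/
def IsOMinimal (D : Set Mt) : Prop :=
  ∃ _ : LinearOrder D,
    (Set.univ : Set (Mt ⊕ Mb)).Definable₂ L
      {p | ∃ x y : D, x < y ∧ p = (Sum.inl (x : Mt), Sum.inl (y : Mt))} ∧
    DenselyOrdered D ∧ NoMinOrder D ∧ NoMaxOrder D ∧ OrderTopology D ∧
    ∀ S : Set Mt, S ⊆ D → Dfn L Mb S →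
      ∃ F : Set (Set D), F.Finite ∧ (∀ I ∈ F, IsPointOrInterval I) ∧
        (Subtype.val : D → Mt) ⁻¹' S = ⋃₀ F

end Defs

end TTT

/-! The plan is to find a definable tree structure on the space, remove its finitely many branch
points, and orient the remaining pieces.

Tameness. A closed definable set without interior is finite: otherwise dimension 1 would make it
infinite and discrete, against `d < ∞`. By condition (A) every definable set then has finite
frontier (`IsTTT.tame`), and every point has arbitrarily small definably connected open definable
neighbourhoods. From here on only these facts, the Hausdorff property and saturation matter.

Separation. Every point cuts the space, and by ω-saturation finitely many formulas cut at all
points. They give a uniformly definable family of equivalence relations `E x` on the complement of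
`x`, with open classes and at least two of them (`exists_cutRel`). Seen from a base point `p`, the
sets `Far E p x` that the points `x ≠ p` cut off are nested or disjoint (`comparable`), and the
union of a nonempty chain of them has exactly one frontier point (`frontier_upSet`). This replaces
Dedekind completeness and shows that any two points are separated by a third (`exists_separator`).
Hence `E` can be refined to `Link E`, whose classes are definably connected (`CutRel.treeRel`).

Branch points. The points separating `x` from `y` accumulate at `x`, and no interior point of their
set is a branch point, so there are only finitely many branch points (`finite_branch`). They form
the set to be removed. In a component `C` of the rest, one of any three points separates the other
two, since otherwise `exists_median` yields a branch point in `C`. Separation on `C` is therefore a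
linear betweenness relation. Orienting it gives the order, and connected segments together with
finite frontiers give o-minimality. -/

namespace TTT

open Set FirstOrder FirstOrder.Language

universe u v w w' x
set_option autoImplicit false

/-- A type of contexts: its elements are coded by finite tuples of elements of the structure `N`,
and the codes form a set definable without parameters. -/
class Ctx (L : FirstOrder.Language.{w, w'}) (N : Type u) [L.Structure N] (Γ : Type x) where
  ι : Type
  [fin : Finite ι]
  enc : Γ → ι → N
  inj : Function.Injective enc
  dfn : (∅ : Set N).Definable L (range enc)

/-- The sort of points is definable without parameters. -/
class SortDefinable (L : FirstOrder.Language.{w, w'}) (Mt : Type u) (Mb : Type v)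
    [L.Structure (Mt ⊕ Mb)] : Prop where
  out : (∅ : Set (Mt ⊕ Mb)).Definable₁ L (range (Sum.inl : Mt → Mt ⊕ Mb))

theorem definable_of_eq {L : FirstOrder.Language.{w, w'}} {N : Type u} [L.Structure N] {A : Set N}
    {α : Type x} {s t : Set (α → N)} (h : A.Definable L s) (e : t = s) : A.Definable L t := e ▸ h

/-! ### A calculus of definable predicates on tuples of points, parameters and elements. -/

section Contexts

variable {L : FirstOrder.Language.{w, w'}} {N : Type u} [L.Structure N]

instance Ctx.finite {Γ : Type x} [c : Ctx L N Γ] : Finite c.ι := c.fin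

instance Ctx.self : Ctx L N N where
  ι := Fin 1
  enc a _ := a
  inj a b h := congrFun h 0
  dfn := by
    convert! definable_univ
    ext v
    simp only [mem_range, mem_univ, iff_true]
    exact ⟨v 0, funext fun i => by rw [Subsingleton.elim i 0]⟩

instance Ctx.unit : Ctx L N Unit where
  ι := Fin 0
  enc _ i := i.elim0
  inj _ _ _ := rfl
  dfn := by
    convert! definable_univ
    ext v
    simp only [mem_range, mem_univ, iff_true]
    exact ⟨(), funext fun i => i.elim0⟩

instance Ctx.prod {Γ Δ : Type*} [c : Ctx L N Γ] [d : Ctx L N Δ] : Ctx L N (Γ × Δ) where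
  ι := c.ι ⊕ d.ι
  enc p := Sum.elim (c.enc p.1) (d.enc p.2)
  inj p q h := by
    refine Prod.ext (c.inj ?_) (d.inj ?_)
    · exact congrArg (· ∘ Sum.inl) h
    · exact congrArg (· ∘ Sum.inr) h
  dfn := by
    convert! (c.dfn.preimage_comp Sum.inl).inter (d.dfn.preimage_comp Sum.inr)
    ext v
    constructor
    · rintro ⟨p, rfl⟩
      exact ⟨⟨p.1, rfl⟩, ⟨p.2, rfl⟩⟩
    · rintro ⟨⟨g, hg⟩, ⟨e, he⟩⟩
      refine ⟨(g, e), ?_⟩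
      have hg' : c.enc g = v ∘ Sum.inl := hg
      have he' : d.enc e = v ∘ Sum.inr := he
      change Sum.elim (c.enc g) (d.enc e) = v
      rw [hg', he', Sum.elim_comp_inl_inr]

instance Ctx.pi {Γ : Type*} [c : Ctx L N Γ] (m : ℕ) : Ctx L N (Fin m → Γ) where
  ι := Fin m × c.ι
  enc z p := c.enc (z p.1) p.2
  inj y z h := funext fun i => c.inj (funext fun j => congrFun h (i, j))
  dfn := by
    convert! definable_iInter_of_finite
      (fun i : Fin m => c.dfn.preimage_comp (fun j : c.ι => (i, j)))
    ext v
    simp only [mem_range, mem_iInter, mem_preimage]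
    constructor
    · rintro ⟨z, rfl⟩ i
      exact ⟨z i, rfl⟩
    · intro h
      choose z hz using h
      exact ⟨z, funext fun p => congrFun (hz p.1) p.2⟩

instance Ctx.points {Mt : Type u} {Mb : Type v} [L.Structure (Mt ⊕ Mb)]
    [SortDefinable L Mt Mb] : Ctx L (Mt ⊕ Mb) Mt where
  ι := Fin 1
  enc a _ := Sum.inl a
  inj a b h := Sum.inl_injective (congrFun h 0)
  dfn := by
    refine definable_of_eq
      (SortDefinable.out : (∅ : Set (Mt ⊕ Mb)).Definable₁ L (range Sum.inl)) ?_
    ext v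
    constructor
    · rintro ⟨a, rfl⟩
      exact ⟨a, rfl⟩
    · rintro ⟨a, ha⟩
      exact ⟨a, funext fun i => ha.trans (congrArg v (Subsingleton.elim 0 i))⟩

instance Ctx.parameters {Mt : Type u} {Mb : Type v} [L.Structure (Mt ⊕ Mb)]
    [SortDefinable L Mt Mb] : Ctx L (Mt ⊕ Mb) Mb where
  ι := Fin 1
  enc a _ := Sum.inr a
  inj a b h := Sum.inr_injective (congrFun h 0)
  dfn := by
    convert! (SortDefinable.out : (∅ : Set (Mt ⊕ Mb)).Definable₁ L (range Sum.inl)).compl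
    ext v
    constructor
    · rintro ⟨a, rfl⟩ ⟨b, hb⟩
      cases hb
    · intro h
      rcases hv : v 0 with a | b
      · exact (h ⟨a, hv.symm⟩).elim
      · exact ⟨b, funext fun i => by rw [Subsingleton.elim i 0, hv]⟩

variable (L)

/-- A predicate on a type of contexts is definable with parameters from `A`. -/
def DP (A : Set N) {Γ : Type x} [c : Ctx L N Γ] (P : Γ → Prop) : Prop :=
  A.Definable L (c.enc '' {g | P g})

/-- A map between types of contexts all of whose coordinates are coordinates of the argument or
constants from `A`. -/
def DMap (A : Set N) {Γ Δ : Type*} [c : Ctx L N Γ] [d : Ctx L N Δ] (f : Γ → Δ) : Prop :=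
  ∀ j, (∃ i, ∀ g, d.enc (f g) j = c.enc g i) ∨ ∃ a ∈ A, ∀ g, d.enc (f g) j = a

variable {L} {A : Set N} {Γ Δ Θ : Type*} [c : Ctx L N Γ] [d : Ctx L N Δ] [e : Ctx L N Θ]

theorem DMap.id : DMap L A (fun g : Γ => g) := fun j => Or.inl ⟨j, fun _ => rfl⟩

theorem DMap.fst {f : Γ → Δ × Θ} (hf : DMap L A f) : DMap L A (fun g => (f g).1) :=
  fun j => hf (Sum.inl j)

theorem DMap.snd {f : Γ → Δ × Θ} (hf : DMap L A f) : DMap L A (fun g => (f g).2) :=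
  fun j => hf (Sum.inr j)

theorem DMap.pair {f : Γ → Δ} {f' : Γ → Θ} (hf : DMap L A f) (hf' : DMap L A f') :
    DMap L A (fun g => (f g, f' g)) := by
  rintro (j | j)
  · exact hf j
  · exact hf' j

theorem DMap.const (a : Δ) : DMap L (univ : Set N) (fun _ : Γ => a) :=
  fun j => Or.inr ⟨d.enc a j, mem_univ _, fun _ => rfl⟩

theorem DMap.comp {f : Δ → Θ} {g : Γ → Δ} (hf : DMap L A f) (hg : DMap L A g) :
    DMap L A (fun x => f (g x)) := by
  intro j
  rcases hf j with ⟨i, hi⟩ | ⟨a, ha, hi⟩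
  · rcases hg i with ⟨k, hk⟩ | ⟨a, ha, hk⟩
    · exact Or.inl ⟨k, fun x => (hi _).trans (hk x)⟩
    · exact Or.inr ⟨a, ha, fun x => (hi _).trans (hk x)⟩
  · exact Or.inr ⟨a, ha, fun x => hi _⟩

theorem DP.congr {P Q : Γ → Prop} (hP : DP L A P) (h : ∀ g, P g ↔ Q g) : DP L A Q := by
  have : P = Q := funext fun g => propext (h g)
  exact this ▸ hP

theorem DP.and {P Q : Γ → Prop} (hP : DP L A P) (hQ : DP L A Q) :
    DP L A (fun g => P g ∧ Q g) := by
  have h := Definable.inter hP hQ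
  rw [← image_inter c.inj] at h
  exact h

theorem DP.not {P : Γ → Prop} (hP : DP L A P) : DP L A (fun g => ¬ P g) := by
  have h := (c.dfn.mono (empty_subset A)).sdiff hP
  rw [← image_univ, ← image_sdiff c.inj] at h
  refine definable_of_eq h (congrArg _ ?_)
  ext g
  simp

theorem DP.or {P Q : Γ → Prop} (hP : DP L A P) (hQ : DP L A Q) :
    DP L A (fun g => P g ∨ Q g) :=
  (hP.not.and hQ.not).not.congr fun g => by tauto

theorem DP.imp {P Q : Γ → Prop} (hP : DP L A P) (hQ : DP L A Q) :
    DP L A (fun g => P g → Q g) :=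
  (hP.and hQ.not).not.congr fun g => by tauto

theorem DP.iff {P Q : Γ → Prop} (hP : DP L A P) (hQ : DP L A Q) :
    DP L A (fun g => P g ↔ Q g) :=
  ((hP.imp hQ).and (hQ.imp hP)).congr fun g => by tauto

theorem DP.ex {P : Γ → Δ → Prop} (hP : DP L A (fun p : Γ × Δ => P p.1 p.2)) :
    DP L A (fun g => ∃ x, P g x) := by
  have h := Definable.exists_of_finite hP
  refine definable_of_eq h ?_
  ext v
  constructor
  · rintro ⟨g, ⟨x, hx⟩, rfl⟩
    exact ⟨d.enc x, (g, x), hx, rfl⟩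
  · rintro ⟨u, ⟨g, x⟩, hx, h⟩
    exact ⟨g, ⟨x, hx⟩, congrArg (· ∘ Sum.inl) h⟩

theorem DP.all {P : Γ → Δ → Prop} (hP : DP L A (fun p : Γ × Δ => P p.1 p.2)) :
    DP L A (fun g => ∀ x, P g x) :=
  (DP.ex (P := fun g x => ¬ P g x) hP.not).not.congr fun g => by simp

theorem DP.comp {P : Δ → Prop} (hP : DP L A P) {f : Γ → Δ} (hf : DMap L A f) :
    DP L A (fun g => P (f g)) := by
  classical
  -- A definable map on all tuples of codes that agrees with `f` on codes of elements of `Γ`; the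
  -- last branch of the definition never occurs.
  let F : (c.ι → N) → d.ι → N := fun v j =>
    if h : ∃ i, ∀ g, d.enc (f g) j = c.enc g i then v h.choose
    else if h : ∃ a ∈ A, ∀ g, d.enc (f g) j = a then h.choose else v (h ((hf j).resolve_left ‹_›)).elim
  have hF : A.DefinableMap L F := by
    intro j
    by_cases h : ∃ i, ∀ g, d.enc (f g) j = c.enc g i
    · simp only [F, dif_pos h]
      exact DefinableFun.proj L
    · have h' := (hf j).resolve_left h
      simp only [F, dif_neg h, dif_pos h']
      exact definableFun_const L _ h'.choose_spec.1
  have hFe : ∀ g, F (c.enc g) = d.enc (f g) := by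
    intro g
    funext j
    by_cases h : ∃ i, ∀ g, d.enc (f g) j = c.enc g i
    · simp only [F, dif_pos h]
      exact (h.choose_spec g).symm
    · have h' := (hf j).resolve_left h
      simp only [F, dif_neg h, dif_pos h']
      exact (h'.choose_spec.2 g).symm
  have := (c.dfn.mono (empty_subset A)).inter (Definable.preimage_map hF hP)
  refine definable_of_eq this ?_
  ext v
  constructor
  · rintro ⟨g, hg, rfl⟩
    exact ⟨⟨g, rfl⟩, f g, hg, (hFe g).symm⟩
  · rintro ⟨⟨g, rfl⟩, y, hy, hyv⟩
    obtain rfl : y = f g := d.inj (hyv.trans (hFe g))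
    exact ⟨g, hy, rfl⟩

theorem DP.eq {f f' : Γ → Δ} (hf : DMap L A f) (hf' : DMap L A f') :
    DP L A (fun g => f g = f' g) := by
  have h : DP L A (fun p : Δ × Δ => p.1 = p.2) := by
    have h1 : ∀ j : d.ι, A.Definable L {v : d.ι ⊕ d.ι → N | v (Sum.inl j) = v (Sum.inr j)} :=
      fun j => DefinableFun.ofPred_eq (DefinableFun.proj L) (DefinableFun.proj L)
    have h2 := ((Ctx.dfn (L := L) (N := N) (Γ := Δ × Δ)).mono (empty_subset A)).inter
      (definable_iInter_of_finite h1)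
    refine definable_of_eq h2 ?_
    ext v
    simp only [mem_image, mem_inter_iff, mem_range, mem_iInter]
    constructor
    · rintro ⟨⟨a, b⟩, hab, rfl⟩
      refine ⟨⟨_, rfl⟩, fun j => ?_⟩
      have hab' : a = b := hab
      subst hab'
      rfl
    · rintro ⟨⟨⟨a, b⟩, rfl⟩, h⟩
      exact ⟨(a, b), d.inj (funext h), rfl⟩
  exact h.comp (hf.pair hf')

theorem DP.forall_finset {κ : Type*} (F : Finset κ) {P : κ → Γ → Prop}
    (h : ∀ i, DP L A (P i)) : DP L A (fun g => ∀ i ∈ F, P i g) := by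
  classical
  induction F using Finset.induction_on with
  | empty =>
    exact (DP.eq DMap.id DMap.id).congr fun g => by simp
  | insert i F _ ih => exact ((h i).and ih).congr fun g => by simp

theorem DP.realize {A : Set N} {m : ℕ} (ψ : L.Formula (Fin m ⊕ Unit)) :
    DP L A (fun p : (Fin m → N) × N => ψ.Realize (Sum.elim p.1 (fun _ => p.2))) := by
  have h : (∅ : Set N).Definable L {v : Fin m ⊕ Unit → N | ψ.Realize v} :=
    empty_definable_iff.2 ⟨ψ, rfl⟩
  have h2 := ((h.preimage_comp (fun i => (Sum.map (fun i => (i, 0)) (fun _ => 0) i :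
    (Fin m × Fin 1) ⊕ Fin 1))).mono (empty_subset A)).inter
    ((Ctx.dfn (L := L) (N := N) (Γ := (Fin m → N) × N)).mono (empty_subset A))
  refine definable_of_eq h2 ?_
  have key : ∀ p : (Fin m → N) × N, ψ.Realize (Sum.elim p.1 (fun _ => p.2)) ↔
      ψ.Realize ((Ctx.enc (L := L) (N := N) p : (Fin m × Fin 1) ⊕ Fin 1 → N) ∘
        Sum.map (fun i => (i, (0 : Fin 1))) (fun _ => (0 : Fin 1))) := by
    intro p
    apply iff_of_eq
    congr 1
    funext i
    rcases i with i | i <;> rfl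
  ext v
  constructor
  · rintro ⟨p, hp, rfl⟩
    exact ⟨(key p).1 hp, p, rfl⟩
  · rintro ⟨hv, p, rfl⟩
    exact ⟨p, (key p).2 hv, rfl⟩

end Contexts

/-! ### Definable sets of points. -/

section Points

variable {L : FirstOrder.Language.{w, w'}} {Mt : Type u} {Mb : Type v} [L.Structure (Mt ⊕ Mb)]
  [SortDefinable L Mt Mb]

theorem dp_iff_dfn {P : Mt → Prop} :
    DP L (univ : Set (Mt ⊕ Mb)) P ↔ Dfn L Mb {x | P x} := by
  unfold DP Dfn Definable₁
  suffices h : ((Ctx.points : Ctx L (Mt ⊕ Mb) Mt).enc '' {x | P x}) =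
      {v : Fin 1 → Mt ⊕ Mb | v 0 ∈ Sum.inl '' {x | P x}} by rw [← h]
  ext v
  constructor
  · rintro ⟨a, ha, rfl⟩
    exact ⟨a, ha, rfl⟩
  · rintro ⟨a, ha, hav⟩
    refine ⟨a, ha, funext fun i => ?_⟩
    rw [show i = (0 : Fin 1) from Subsingleton.elim (α := Fin 1) i 0]
    exact hav

theorem DMap.inl {A : Set (Mt ⊕ Mb)} :
    DMap L A (fun x : Mt => (Sum.inl x : Mt ⊕ Mb)) :=
  fun _ => Or.inl ⟨(0 : Fin 1), fun _ => rfl⟩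

theorem dp_basicSet {A : Set (Mt ⊕ Mb)} {k : ℕ} (φ : L.Formula (Unit ⊕ Fin k)) :
    DP L A (fun p : Mt × (Fin k → Mb) => p.1 ∈ basicSet L Mb φ p.2) := by
  have h : (∅ : Set (Mt ⊕ Mb)).Definable L {v : Unit ⊕ Fin k → Mt ⊕ Mb | φ.Realize v} :=
    empty_definable_iff.2 ⟨φ, rfl⟩
  have h2 := ((h.preimage_comp (fun i => (Sum.map (fun _ => 0) (fun i => (i, 0)) i :
    Fin 1 ⊕ (Fin k × Fin 1)))).mono (empty_subset A)).inter
    ((Ctx.dfn (L := L) (N := Mt ⊕ Mb) (Γ := Mt × (Fin k → Mb))).mono (empty_subset A))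
  refine definable_of_eq h2 ?_
  have key : ∀ p : Mt × (Fin k → Mb), p.1 ∈ basicSet L Mb φ p.2 ↔
      φ.Realize ((Ctx.enc (L := L) (N := Mt ⊕ Mb) p :
        Fin 1 ⊕ (Fin k × Fin 1) → Mt ⊕ Mb) ∘ Sum.map (fun _ => (0 : Fin 1)) (fun i => (i, (0 : Fin 1)))) := by
    intro p
    change φ.Realize _ ↔ _
    apply iff_of_eq
    congr 1
    funext i
    rcases i with i | i <;> rfl
  ext v
  constructor
  · rintro ⟨p, hp, rfl⟩
    exact ⟨(key p).1 hp, p, rfl⟩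
  · rintro ⟨hv, p, rfl⟩
    exact ⟨p, (key p).2 hv, rfl⟩

/-- Isolates the parameters as a finite tuple, so that they can be quantified over when saturation
is applied. -/
theorem dfn_iff_exists_formula {X : Set Mt} : Dfn L Mb X ↔
    ∃ (m : ℕ) (ψ : L.Formula (Fin m ⊕ Unit)) (z : Fin m → Mt ⊕ Mb),
      X = {y | ψ.Realize (Sum.elim z (fun _ => Sum.inl y))} := by
  classical
  constructor
  · intro h
    obtain ⟨A0, -, hA⟩ := definable_iff_finitely_definable.1 h
    obtain ⟨φ, hφ⟩ := definable_iff_exists_formula_sum.1 hA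
    let f : A0 ≃ Fin A0.card := A0.equivFin
    refine ⟨A0.card, φ.relabel (Sum.map f (fun _ => ())), fun i => (f.symm i : Mt ⊕ Mb), ?_⟩
    ext y
    have h1 : y ∈ X ↔ (fun _ : Fin 1 => (Sum.inl y : Mt ⊕ Mb)) ∈
        {v : Fin 1 → Mt ⊕ Mb | v 0 ∈ Sum.inl '' X} := by
      simp
    rw [h1, hφ]
    simp only [mem_ofPred_eq, Formula.realize_relabel]
    apply iff_of_eq
    congr 1
    funext i
    rcases i with i | i
    · simp [f]
    · simp
  · rintro ⟨m, ψ, z, rfl⟩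
    rw [← dp_iff_dfn]
    exact (DP.realize ψ).comp ((DMap.const z).pair DMap.inl)

end Points

/-! ### Definable topology, clopen partitions and the finiteness given by dimension 1. -/

section Topology

variable {L : FirstOrder.Language.{w, w'}} {Mt : Type u} {Mb : Type v} [L.Structure (Mt ⊕ Mb)]
  [SortDefinable L Mt Mb]

theorem dfn_iff_dp {X : Set Mt} : Dfn L Mb X ↔ DP L (univ : Set (Mt ⊕ Mb)) (fun x => x ∈ X) :=
  (dp_iff_dfn (P := fun x => x ∈ X)).symm

theorem Dfn.compl {X : Set Mt} (hX : Dfn L Mb X) : Dfn L Mb Xᶜ :=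
  dfn_iff_dp.2 (dfn_iff_dp.1 hX).not

theorem Dfn.inter {X Y : Set Mt} (hX : Dfn L Mb X) (hY : Dfn L Mb Y) : Dfn L Mb (X ∩ Y) :=
  dfn_iff_dp.2 ((dfn_iff_dp.1 hX).and (dfn_iff_dp.1 hY))

theorem Dfn.union {X Y : Set Mt} (hX : Dfn L Mb X) (hY : Dfn L Mb Y) : Dfn L Mb (X ∪ Y) :=
  dfn_iff_dp.2 ((dfn_iff_dp.1 hX).or (dfn_iff_dp.1 hY))

theorem Dfn.diff {X Y : Set Mt} (hX : Dfn L Mb X) (hY : Dfn L Mb Y) : Dfn L Mb (X \ Y) :=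
  dfn_iff_dp.2 ((dfn_iff_dp.1 hX).and (dfn_iff_dp.1 hY).not)

theorem dfn_singleton (a : Mt) : Dfn L Mb {a} :=
  dfn_iff_dp.2 (DP.eq (f := fun x : Mt => x) (f' := fun _ => a) DMap.id (DMap.const a))

theorem dfn_univ : Dfn L Mb (univ : Set Mt) :=
  dfn_iff_dp.2 ((DP.eq (f := fun x : Mt => x) (f' := fun x => x) DMap.id DMap.id).congr
    fun x => by simp)

theorem dfn_empty : Dfn L Mb (∅ : Set Mt) := by
  simpa using (dfn_univ (L := L) (Mt := Mt) (Mb := Mb)).compl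

theorem dfn_finite {X : Set Mt} (hX : X.Finite) : Dfn L Mb X := by
  induction X, hX using Set.Finite.induction_on with
  | empty => exact dfn_empty
  | insert _ _ ih => exact (dfn_singleton _).union ih

variable [TopologicalSpace Mt]

/-- Quantifying over basic open sets is quantifying over `Mb ^ k`, so closures are definable
uniformly in families. -/
theorem dp_closure {A : Set (Mt ⊕ Mb)} {Γ : Type*} [c : Ctx L (Mt ⊕ Mb) Γ] {k : ℕ}
    {φ : L.Formula (Unit ⊕ Fin k)}
    (hφ : TopologicalSpace.IsTopologicalBasis (range (basicSet (Mt := Mt) L Mb φ)))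
    {P : Γ → Mt → Prop} (hP : DP L A (fun p : Γ × Mt => P p.1 p.2)) :
    DP L A (fun p : Γ × Mt => p.2 ∈ closure {y | P p.1 y}) := by
  have h : DP L A (fun p : Γ × Mt => ∀ b : Fin k → Mb, p.2 ∈ basicSet L Mb φ b →
      ∃ y : Mt, y ∈ basicSet L Mb φ b ∧ P p.1 y) := by
    apply DP.all
    apply DP.imp
    · exact (dp_basicSet φ).comp (DMap.id.fst.snd.pair DMap.id.snd)
    · apply DP.ex
      apply DP.and
      · exact (dp_basicSet φ).comp (DMap.id.snd.pair DMap.id.fst.snd)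
      · exact hP.comp (DMap.id.fst.fst.fst.pair DMap.id.snd)
  refine h.congr fun p => ?_
  rw [hφ.mem_closure_iff]
  simp only [forall_mem_range]
  rfl

/-- `X` is definably preconnected: no definable set without frontier points in `X` splits `X`. -/
def PC (L : FirstOrder.Language.{w, w'}) {Mt : Type u} (Mb : Type v) [L.Structure (Mt ⊕ Mb)]
    [TopologicalSpace Mt] (X : Set Mt) : Prop :=
  ∀ S : Set Mt, Dfn L Mb S → Disjoint X (frontier S) → X ⊆ S ∨ Disjoint X S

omit [SortDefinable L Mt Mb] in
theorem isClopen_preimage_val_iff {X S : Set Mt} (hX : IsOpen X) :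
    IsClopen ((Subtype.val : X → Mt) ⁻¹' S) ↔ Disjoint X (frontier S) := by
  rw [isClopen_iff_frontier_eq_empty,
    ← hX.isOpenMap_subtype_val.preimage_frontier_eq_frontier_preimage continuous_subtype_val,
    preimage_eq_empty_iff, Subtype.range_coe, disjoint_comm]

omit [SortDefinable L Mt Mb] in
theorem HasClopenPartition.le_numComponents {X : Set Mt} {d : ℕ}
    (h : HasClopenPartition L Mb X d) : (d : ℕ∞) ≤ numComponents L Mb X :=
  le_iSup (fun d : {d : ℕ // HasClopenPartition L Mb X d} => ((d : ℕ) : ℕ∞)) ⟨d, h⟩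

omit [SortDefinable L Mt Mb] in
theorem hasClopenPartition_zero {X : Set Mt} (h : X = ∅) : HasClopenPartition L Mb X 0 :=
  ⟨fun i => i.elim0, fun i => i.elim0, fun i => i.elim0, by simp [h]⟩

omit [SortDefinable L Mt Mb] in
theorem hasClopenPartition_one {X : Set Mt} (hX : Dfn L Mb X) (h : X.Nonempty) :
    HasClopenPartition L Mb X 1 :=
  ⟨fun _ => X, fun _ => ⟨h, hX, by simp [isClopen_univ]⟩, fun i j hij => (hij (Subsingleton.elim i j)).elim,
    iUnion_const X⟩

omit [SortDefinable L Mt Mb] in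
theorem exists_max_partition {X : Set Mt} (hX : Dfn L Mb X) (h : numComponents L Mb X < ⊤) :
    ∃ d, HasClopenPartition L Mb X d ∧ ∀ d', HasClopenPartition L Mb X d' → d' ≤ d := by
  obtain ⟨n, hn⟩ := ENat.ne_top_iff_exists.1 h.ne
  have hb : ∀ d, HasClopenPartition L Mb X d → d ≤ n := fun d hd => by
    have := hd.le_numComponents
    rw [← hn] at this
    exact_mod_cast this
  have hne : {d | HasClopenPartition L Mb X d}.Nonempty := by
    rcases X.eq_empty_or_nonempty with h | h
    · exact ⟨0, hasClopenPartition_zero h⟩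
    · exact ⟨1, hasClopenPartition_one hX h⟩
  have hbd : BddAbove {d | HasClopenPartition L Mb X d} := ⟨n, hb⟩
  exact ⟨_, Nat.sSup_mem hne hbd, fun d' hd' => le_csSup hbd hd'⟩

/-- The pieces of a largest partition are definably preconnected, since splitting one of them would
give a larger partition. -/
theorem exists_partition_preconnected {X : Set Mt} (hX : Dfn L Mb X) (hXo : IsOpen X)
    (h : numComponents L Mb X < ⊤) :
    ∃ (d : ℕ) (f : Fin d → Set Mt), (∀ i, (f i).Nonempty ∧ Dfn L Mb (f i) ∧ IsOpen (f i) ∧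
      Disjoint X (frontier (f i)) ∧ PC L Mb (f i)) ∧
      Pairwise (fun i j => Disjoint (f i) (f j)) ∧ ⋃ i, f i = X := by
  obtain ⟨d, ⟨f, hf, hd, hU⟩, hmax⟩ := exists_max_partition hX h
  have hsub : ∀ i, f i ⊆ X := fun i => hU ▸ subset_iUnion f i
  have hfr : ∀ i, Disjoint X (frontier (f i)) := fun i =>
    (isClopen_preimage_val_iff hXo).1 (hf i).2.2
  have hop : ∀ {S : Set Mt}, S ⊆ X → Disjoint X (frontier S) → IsOpen S := by
    intro S hS hdj
    rw [← interior_eq_iff_isOpen]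
    refine subset_antisymm interior_subset fun y hy => ?_
    by_contra hyi
    exact disjoint_left.1 hdj (hS hy) ⟨subset_closure hy, hyi⟩
  refine ⟨d, f, fun i => ⟨(hf i).1, (hf i).2.1, hop (hsub i) (hfr i), hfr i, ?_⟩, hd, hU⟩
  intro S hS hdj
  by_contra! hcon
  obtain ⟨hcon1, hcon2⟩ := hcon
  obtain ⟨a, ha, haS⟩ := not_subset.1 hcon1
  obtain ⟨b, hb, hbS⟩ := not_disjoint_iff.1 hcon2
  have key : ∀ T : Set Mt, Disjoint (f i) (frontier T) → Disjoint X (frontier (f i ∩ T)) := by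
    intro T hT
    rw [disjoint_left] at hT ⊢
    intro y hy hyf
    rcases frontier_inter_subset _ _ hyf with h | h
    · exact disjoint_left.1 (hfr i) hy h.1
    · have : y ∈ f i := by
        by_contra hn
        exact disjoint_left.1 (hfr i) hy ⟨h.1, fun hi => hn (interior_subset hi)⟩
      exact hT this h.2
  let g : Fin (d + 1) → Set Mt := Fin.cons (f i ∩ S) (fun j => if j = i then f i ∩ Sᶜ else f j)
  have hg : HasClopenPartition L Mb X (d + 1) := by
    refine ⟨g, ?_, ?_, ?_⟩
    · intro j
      refine Fin.cases ?_ (fun j => ?_) j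
      · exact ⟨⟨b, hb, hbS⟩, (hf i).2.1.inter hS, (isClopen_preimage_val_iff hXo).2 (key S hdj)⟩
      · by_cases hj : j = i
        · simp only [g, Fin.cons_succ, if_pos hj]
          exact ⟨⟨a, ha, haS⟩, (hf i).2.1.inter hS.compl,
            (isClopen_preimage_val_iff hXo).2 (key _ (by rwa [frontier_compl]))⟩
        · simp only [g, Fin.cons_succ, if_neg hj]
          exact hf j
    · have h0 : ∀ j, Disjoint (f i ∩ S) (if j = i then f i ∩ Sᶜ else f j) := by
        intro j
        split_ifs with hj
        · exact (disjoint_compl_right_iff_subset.2 Subset.rfl : Disjoint S Sᶜ).mono inter_subset_right inter_subset_right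
        · exact (hd (Ne.symm hj)).mono_left inter_subset_left
      have hle : ∀ j, (if j = i then f i ∩ Sᶜ else f j) ⊆ f j := by
        intro j
        split_ifs with hj
        · exact hj ▸ inter_subset_left
        · exact Subset.rfl
      intro j l
      refine Fin.cases ?_ (fun j => ?_) j <;> refine Fin.cases ?_ (fun l => ?_) l
      · exact fun h => (h rfl).elim
      · intro _
        simpa only [g, Fin.cons_succ, Fin.cons_zero] using h0 l
      · intro _
        simpa only [g, Fin.cons_succ, Fin.cons_zero] using (h0 j).symm
      · intro hjl
        simp only [g, Fin.cons_succ]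
        exact (hd (fun h => hjl (congrArg _ h))).mono (hle j) (hle l)
    · refine subset_antisymm (iUnion_subset fun j => ?_) ?_
      · refine Fin.cases ?_ (fun j => ?_) j
        · exact inter_subset_left.trans (hsub i)
        · simp only [g, Fin.cons_succ]
          split_ifs
          · exact inter_subset_left.trans (hsub i)
          · exact hsub j
      · rw [← hU]
        refine iUnion_subset fun j y hy => ?_
        rw [mem_iUnion]
        by_cases hj : j = i
        · by_cases hyS : y ∈ S
          · exact ⟨0, hj ▸ hy, hyS⟩
          · refine ⟨i.succ, ?_⟩
            simp only [g, Fin.cons_succ, if_true]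
            exact ⟨hj ▸ hy, hyS⟩
        · refine ⟨j.succ, ?_⟩
          simp only [g, Fin.cons_succ, if_neg hj]
          exact hy
  exact absurd (hmax _ hg) (by omega)

theorem defConnected_iff {X : Set Mt} (hX : Dfn L Mb X) (hXo : IsOpen X) :
    DefConnected L Mb X ↔ X.Nonempty ∧ PC L Mb X := by
  constructor
  · intro h
    have h1 : numComponents L Mb X = 1 := h
    have hle : ∀ d, HasClopenPartition L Mb X d → d ≤ 1 := fun d hd => by
      have := hd.le_numComponents
      rw [h1] at this
      exact_mod_cast this
    have hne : X.Nonempty := by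
      rw [nonempty_iff_ne_empty]
      rintro rfl
      have : numComponents L Mb (∅ : Set Mt) ≤ 0 := by
        refine iSup_le fun d => ?_
        obtain ⟨d, f, hf, -, hU⟩ := d
        rcases d with _ | d
        · simp
        · obtain ⟨y, hy⟩ := (hf 0).1
          have : y ∈ ⋃ i, f i := mem_iUnion.2 ⟨0, hy⟩
          rw [hU] at this
          exact this.elim
      rw [h1] at this
      exact absurd this (by norm_num)
    refine ⟨hne, fun S hS hdj => ?_⟩
    obtain ⟨d, f, hf, hd, hU⟩ := exists_partition_preconnected hX hXo
      (by rw [h1]; exact ENat.natCast_lt_top 1)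
    have hd1 : d ≤ 1 := hle d ⟨f, fun i => ⟨(hf i).1, (hf i).2.1,
      (isClopen_preimage_val_iff hXo).2 (hf i).2.2.2.1⟩, hd, hU⟩
    obtain ⟨y, hy⟩ := hne
    rw [← hU] at hy
    obtain ⟨i, hi⟩ := mem_iUnion.1 hy
    have : X = f i := by
      rw [← hU]
      refine subset_antisymm (iUnion_subset fun j => ?_) (subset_iUnion f i)
      rw [show j = i from Fin.ext (by omega)]
    rw [this] at hdj ⊢
    exact (hf i).2.2.2.2 S hS hdj
  · rintro ⟨hne, hpc⟩
    refine le_antisymm (iSup_le fun d => ?_) (by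
      simpa using (hasClopenPartition_one hX hne).le_numComponents)
    obtain ⟨d, f, hf, hd, hU⟩ := d
    by_contra hlt
    have hd2 : 2 ≤ d := by
      by_contra h
      exact hlt (by exact_mod_cast (show d ≤ 1 by omega))
    obtain ⟨a, ha⟩ := (hf ⟨0, by omega⟩).1
    obtain ⟨b, hb⟩ := (hf ⟨1, by omega⟩).1
    have hdis := hd (show (⟨0, by omega⟩ : Fin d) ≠ ⟨1, by omega⟩ by simp)
    rcases hpc _ (hf ⟨0, by omega⟩).2.1
      ((isClopen_preimage_val_iff hXo).1 (hf ⟨0, by omega⟩).2.2) with h | h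
    · exact disjoint_left.1 hdis (h (hU ▸ mem_iUnion.2 ⟨_, hb⟩)) hb
    · exact disjoint_left.1 h (hU ▸ mem_iUnion.2 ⟨_, ha⟩) ha

/-- Any `n` points of `Y`, as singletons, together with the rest of `Y` form a clopen partition. -/
theorem numComponents_eq_top_of_discrete {Y : Set Mt} (hY : Dfn L Mb Y) (hinf : Y.Infinite)
    (hdisc : ∀ y : Y, IsOpen ({y} : Set Y)) : numComponents L Mb Y = ⊤ := by
  have : DiscreteTopology Y := discreteTopology_iff_isOpen_singleton.2 hdisc
  rw [ENat.eq_top_iff_forall_ge]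
  intro n
  obtain ⟨t, htY, htc⟩ := hinf.exists_subset_card_eq n
  let e := t.equivFinOfCardEq htc
  have hne : (Y \ (t : Set Mt)).Nonempty := by
    rw [nonempty_iff_ne_empty]
    intro h
    exact hinf (t.finite_toSet.subset (sdiff_eq_empty.1 h))
  have hmem : ∀ i : Fin n, ((e.symm i : t) : Mt) ∈ t := fun i => (e.symm i).2
  have hp : HasClopenPartition L Mb Y (n + 1) := by
    refine ⟨Fin.cons (Y \ (t : Set Mt)) (fun i => {((e.symm i : t) : Mt)}), ?_, ?_, ?_⟩
    · intro j
      refine Fin.cases ?_ (fun j => ?_) j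
      · exact ⟨hne, hY.diff (dfn_finite t.finite_toSet), isClopen_discrete _⟩
      · exact ⟨singleton_nonempty _, dfn_singleton _, isClopen_discrete _⟩
    · have h0 : ∀ j : Fin n, Disjoint (Y \ (t : Set Mt)) {((e.symm j : t) : Mt)} := fun j => by
        rw [disjoint_singleton_right]
        exact fun h => h.2 (hmem j)
      intro j l
      refine Fin.cases ?_ (fun j => ?_) j <;> refine Fin.cases ?_ (fun l => ?_) l
      · exact fun h => (h rfl).elim
      · exact fun _ => h0 l
      · exact fun _ => (h0 j).symm
      · intro hjl
        simp only [Fin.cons_succ, disjoint_singleton]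
        intro h
        exact hjl (congrArg _ (e.symm.injective (Subtype.ext h)))
    · refine subset_antisymm (iUnion_subset fun j => ?_) fun y hy => ?_
      · refine Fin.cases ?_ (fun j => ?_) j
        · exact sdiff_subset
        · exact singleton_subset_iff.2 (htY (hmem j))
      · rw [mem_iUnion]
        by_cases hyt : y ∈ t
        · refine ⟨(e ⟨y, hyt⟩).succ, ?_⟩
          simp
        · exact ⟨0, hy, hyt⟩
  refine le_trans ?_ hp.le_numComponents
  exact_mod_cast Nat.le_succ n

theorem finite_of_dimEq_one [T2Space Mt]
    (hnum : ∀ X : Set Mt, Dfn L Mb X → numComponents L Mb X < ⊤)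
    (hdim : DimEq L Mb 1 (univ : Set Mt)) {Y : Set Mt} (hYc : IsClosed Y) (hY : Dfn L Mb Y)
    (hYi : interior Y = ∅) : Y.Finite := by
  by_contra hinf
  -- Since `Y` has empty interior, `D(Y) ≥ 1` would give the whole space dimension at least 2. So no
  -- point of `Y` has empty interior in `Y`, that is, `Y` is discrete.
  have h1 : ¬ DimGE L Mb 1 Y := fun h => hdim.2 <| by
    refine DimGE.succ hYc hY (subset_univ _) ?_ h
    rw [← isOpen_univ.isOpenMap_subtype_val.preimage_interior_eq_interior_preimage
      continuous_subtype_val, hYi, preimage_empty]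
  refine (hnum Y hY).ne (numComponents_eq_top_of_discrete hY hinf fun y => ?_)
  by_contra hy
  apply h1
  have h01 : (1 : Ordinal.{u}) = Order.succ 0 := by simp
  rw [h01]
  refine DimGE.succ (isClosed_singleton (x := (y : Mt))) (dfn_singleton _)
    (singleton_subset_iff.2 y.2) ?_ (DimGE.zero (singleton_nonempty _))
  have hs : (Subtype.val : Y → Mt) ⁻¹' {(y : Mt)} = {y} := by
    ext z
    simp [Subtype.ext_iff]
  rw [hs]
  rcases subset_singleton_iff_eq.1 (interior_subset (s := ({y} : Set Y))) with h | h
  · exact h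
  · exact (hy (interior_eq_iff_isOpen.1 h)).elim

end Topology

/-- A definably connected topological structure in which definable sets of points have
finite frontiers and finitely many definably connected components. -/
class Tame (L : FirstOrder.Language.{w, w'}) (Mt : Type u) (Mb : Type v) [L.Structure (Mt ⊕ Mb)]
    [TopologicalSpace Mt] : Prop extends SortDefinable L Mt Mb where
  exists_basis : ∃ (k : ℕ) (φ : L.Formula (Unit ⊕ Fin k)),
    TopologicalSpace.IsTopologicalBasis (range (basicSet (Mt := Mt) L Mb φ))
  finite_frontier : ∀ X : Set Mt, Dfn L Mb X → (frontier X).Finite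
  numComponents_lt_top : ∀ X : Set Mt, Dfn L Mb X → numComponents L Mb X < ⊤
  preconnected : PC L Mb (univ : Set Mt)

/-- The frontier of an open definable set is closed with empty interior, hence finite, and
finiteness of frontiers survives boolean combinations. -/
theorem IsTTT.tame {L : FirstOrder.Language.{w, w'}} {Mt : Type u} {Mb : Type v}
    [L.Structure (Mt ⊕ Mb)] [TopologicalSpace Mt] {k : ℕ} {φ : L.Formula (Unit ⊕ Fin k)}
    (hM : IsTTT (Mt := Mt) L Mb φ) (hdim : DimEq L Mb 1 (univ : Set Mt))
    (hconn : DefConnected L Mb (univ : Set Mt)) : Tame L Mt Mb := by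
  have : SortDefinable L Mt Mb := ⟨hM.sort_definable⟩
  have := hM.t2
  refine { exists_basis := ⟨k, φ, hM.isTopologicalBasis⟩, finite_frontier := ?_,
           numComponents_lt_top := hM.numComponents_lt_top,
           preconnected := ((defConnected_iff dfn_univ isOpen_univ).1 hconn).2 }
  intro X hX
  have hXA := hM.conditionA X hX
  clear hX
  induction hXA using BooleanSubalgebra.closure_bot_sup_induction with
  | mem U hU =>
    have hcl : ∀ {Y : Set Mt}, Dfn L Mb Y → Dfn L Mb (closure Y) := fun {Y} hY =>
      dfn_iff_dp.2 ((dp_closure hM.isTopologicalBasis (Γ := Unit) (P := fun _ y => y ∈ Y)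
        ((dfn_iff_dp.1 hY).comp DMap.id.snd)).comp ((DMap.const ()).pair DMap.id))
    refine finite_of_dimEq_one hM.numComponents_lt_top hdim isClosed_frontier ?_
      (by rw [← frontier_compl]; exact interior_frontier hU.1.isClosed_compl)
    rw [hU.1.frontier_eq]
    exact (hcl hU.2).diff hU.2
  | bot => simp
  | sup U _ V _ hU hV =>
    refine (hU.union hV).subset ((frontier_union_subset U V).trans ?_)
    exact union_subset_union inter_subset_left inter_subset_right
  | compl U _ hU => rwa [frontier_compl]

/-! ### Definably preconnected sets and local connectedness. -/

section Preconnected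

variable {L : FirstOrder.Language.{w, w'}} {Mt : Type u} {Mb : Type v} [L.Structure (Mt ⊕ Mb)]
  [TopologicalSpace Mt]

theorem PC.subset_closure {X Y : Set Mt} (hX : PC L Mb X) (hXY : X ⊆ Y) (hY : Y ⊆ closure X) :
    PC L Mb Y := by
  intro S hS hdj
  rcases hX S hS (hdj.mono_left hXY) with h | h
  · left
    intro y hy
    by_contra hyS
    exact disjoint_left.1 hdj hy ⟨closure_mono h (hY hy), fun hi => hyS (interior_subset hi)⟩
  · right
    rw [disjoint_left]
    intro y hy hyS
    have h1 : y ∈ interior S := by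
      by_contra hi
      exact disjoint_left.1 hdj hy ⟨_root_.subset_closure hyS, hi⟩
    obtain ⟨z, hz, hzX⟩ := mem_closure_iff.1 (hY hy) _ isOpen_interior h1
    exact disjoint_left.1 h hzX (interior_subset hz)

theorem PC.sUnion {F : Set (Set Mt)} {c : Mt} (hF : ∀ X ∈ F, PC L Mb X ∧ c ∈ X) :
    PC L Mb (⋃₀ F) := by
  intro S hS hdj
  by_cases hc : c ∈ S
  · left
    refine sUnion_subset fun X hX => ?_
    rcases (hF X hX).1 S hS (hdj.mono_left (subset_sUnion_of_mem hX)) with h | h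
    · exact h
    · exact (disjoint_left.1 h (hF X hX).2 hc).elim
  · right
    rw [disjoint_sUnion_left]
    intro X hX
    rcases (hF X hX).1 S hS (hdj.mono_left (subset_sUnion_of_mem hX)) with h | h
    · exact (hc (h (hF X hX).2)).elim
    · exact h

theorem PC.union {X Y : Set Mt} {c : Mt} (hX : PC L Mb X) (hY : PC L Mb Y) (hcX : c ∈ X)
    (hcY : c ∈ Y) : PC L Mb (X ∪ Y) := by
  rw [← sUnion_pair]
  refine PC.sUnion (c := c) ?_
  rintro Z (rfl | rfl)
  · exact ⟨hX, hcX⟩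
  · exact ⟨hY, hcY⟩

theorem PC.subset_of_mem {X S : Set Mt} {c : Mt} (hX : PC L Mb X) (hS : Dfn L Mb S)
    (hdj : Disjoint X (frontier S)) (hcX : c ∈ X) (hcS : c ∈ S) : X ⊆ S :=
  (hX S hS hdj).resolve_right fun h => disjoint_left.1 h hcX hcS

variable [Tame L Mt Mb]

theorem dp_closure' {A : Set (Mt ⊕ Mb)} {Γ : Type*} [c : Ctx L (Mt ⊕ Mb) Γ]
    {P : Γ → Mt → Prop} (hP : DP L A (fun p : Γ × Mt => P p.1 p.2)) :
    DP L A (fun p : Γ × Mt => p.2 ∈ closure {y | P p.1 y}) := by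
  obtain ⟨k, φ, hφ⟩ := Tame.exists_basis (L := L) (Mt := Mt) (Mb := Mb)
  exact dp_closure hφ hP

theorem dp_isOpen {A : Set (Mt ⊕ Mb)} {Γ : Type*} [c : Ctx L (Mt ⊕ Mb) Γ]
    {P : Γ → Mt → Prop} (hP : DP L A (fun p : Γ × Mt => P p.1 p.2)) :
    DP L A (fun g : Γ => IsOpen {y | P g y}) := by
  have h1 : DP L A (fun g : Γ => ∀ y, P g y → ¬ y ∈ closure {y | ¬ P g y}) :=
    (hP.imp (dp_closure' (P := fun g y => ¬ P g y) hP.not).not).all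
  refine h1.congr fun g => ?_
  rw [← isClosed_compl_iff, ← closure_subset_iff_isClosed]
  constructor
  · intro h y hy hyP
    exact h y hyP hy
  · intro h y hyP hy
    exact h hy hyP

theorem exists_preconnected_component {U : Set Mt} {x : Mt} (hU : Dfn L Mb U) (hUo : IsOpen U)
    (hx : x ∈ U) : ∃ K, Dfn L Mb K ∧ IsOpen K ∧ PC L Mb K ∧ x ∈ K ∧ K ⊆ U ∧
      Disjoint U (frontier K) := by
  obtain ⟨d, f, hf, -, hfU⟩ := exists_partition_preconnected hU hUo
    (Tame.numComponents_lt_top U hU)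
  obtain ⟨i, hi⟩ := mem_iUnion.1 (hfU.symm ▸ hx)
  exact ⟨f i, (hf i).2.1, (hf i).2.2.1, (hf i).2.2.2.2, hi, hfU ▸ subset_iUnion f i,
    (hf i).2.2.2.1⟩

theorem exists_preconnected_nhd (L : FirstOrder.Language.{w, w'}) (Mb : Type v)
    [L.Structure (Mt ⊕ Mb)] [Tame L Mt Mb] {U : Set Mt} {x : Mt} (hUo : IsOpen U) (hx : x ∈ U) :
    ∃ K, Dfn L Mb K ∧ IsOpen K ∧ PC L Mb K ∧ x ∈ K ∧ K ⊆ U := by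
  obtain ⟨k, φ, hφ⟩ := Tame.exists_basis (L := L) (Mt := Mt) (Mb := Mb)
  obtain ⟨B, ⟨b, rfl⟩, hxB, hBU⟩ := hφ.exists_subset_of_mem_open hx hUo
  have hB : Dfn L Mb (basicSet (Mt := Mt) L Mb φ b) :=
    dfn_iff_dp.2 ((dp_basicSet φ).comp (DMap.id.pair (DMap.const b)))
  obtain ⟨K, h1, h2, h3, h4, h5, -⟩ :=
    exists_preconnected_component hB (hφ.isOpen ⟨b, rfl⟩) hxB
  exact ⟨K, h1, h2, h3, h4, h5.trans hBU⟩

theorem finite_of_interior_eq_empty {S : Set Mt} (hS : Dfn L Mb S) (h : interior S = ∅) :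
    S.Finite :=
  (Tame.finite_frontier S hS).subset fun y hy => ⟨_root_.subset_closure hy, by simp [h]⟩

theorem eq_univ_of_frontier_eq_empty {S : Set Mt} (hS : Dfn L Mb S) (h : frontier S = ∅)
    (hne : S.Nonempty) : S = univ := by
  obtain ⟨c, hc⟩ := hne
  exact univ_subset_iff.1 ((Tame.preconnected (L := L) (Mb := Mb)).subset_of_mem hS
    (by simp [h]) (mem_univ c) hc)

/-- If the frontier of `A` is contained in `{x}`, then adding `x` to `A` makes it preconnected. -/
theorem preconnected_insert {A : Set Mt} {x : Mt} (hA : Dfn L Mb A)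
    (hx : x ∉ A) (hf : frontier A ⊆ {x}) : PC L Mb (insert x A) := by
  -- Otherwise `A \ S` is a nonempty definable set without frontier, hence the whole space, although
  -- it omits `x`.
  have key : ∀ S : Set Mt, Dfn L Mb S → Disjoint (insert x A) (frontier S) → x ∈ S → A ⊆ S := by
    intro S hS hdj hxS
    by_contra hAS
    have hne : (A \ S).Nonempty := sdiff_nonempty.2 hAS
    have hfr : frontier (A \ S) = ∅ := by
      rw [eq_empty_iff_forall_notMem]
      intro y hy
      rw [sdiff_eq] at hy
      have hy' : y ∈ frontier S → y ∉ insert x A := fun h h' => disjoint_left.1 hdj h' h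
      rcases frontier_inter_subset _ _ hy with ⟨h1, h2⟩ | ⟨h1, h2⟩
      · obtain rfl : y = x := hf h1
        have : y ∈ interior S := by
          by_contra hi
          exact hy' ⟨_root_.subset_closure hxS, hi⟩ (mem_insert _ _)
        rw [closure_compl] at h2
        exact h2 this
      · rw [frontier_compl] at h2
        have h3 := hy' h2
        have : y ∈ frontier A := ⟨h1, fun hi => h3 (mem_insert_of_mem _ (interior_subset hi))⟩
        exact h3 (hf this ▸ mem_insert _ _)
    have := eq_univ_of_frontier_eq_empty (hA.diff hS) hfr hne
    exact hx (this ▸ mem_univ x : x ∈ A \ S).1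
  intro S hS hdj
  by_cases hxS : x ∈ S
  · exact Or.inl (insert_subset hxS (key S hS hdj hxS))
  · right
    have := key Sᶜ hS.compl (by rwa [frontier_compl]) hxS
    rw [← subset_compl_iff_disjoint_right]
    exact insert_subset hxS this

end Preconnected

/-! ### A uniformly definable family of cuts, by saturation. -/

section Saturation

variable {L : FirstOrder.Language.{w, w'}} {Mt : Type u} {Mb : Type v} [L.Structure (Mt ⊕ Mb)]
  [TopologicalSpace Mt]

/-- `U` and its complement in `{x}ᶜ` form a nontrivial open partition of `{x}ᶜ`. -/
def Cuts (x : Mt) (U : Set Mt) : Prop :=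
  x ∉ U ∧ IsOpen U ∧ IsOpen ({x}ᶜ \ U) ∧ U.Nonempty ∧ ({x}ᶜ \ U).Nonempty

theorem Cuts.frontier_subset {x : Mt} {U : Set Mt} (h : Cuts x U) : frontier U ⊆ {x} := by
  intro y hy
  by_contra hyx
  rw [h.2.1.frontier_eq] at hy
  obtain ⟨z, hz, hzU⟩ := mem_closure_iff.1 hy.1 _ h.2.2.1 ⟨hyx, hy.2⟩
  exact hz.2 hzU

theorem exists_cuts [T2Space Mt] {x : Mt} (h : 2 ≤ numComponents L Mb ({x}ᶜ : Set Mt)) :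
    ∃ U : Set Mt, Dfn L Mb U ∧ Cuts x U := by
  have h1 : (1 : ℕ∞) < numComponents L Mb ({x}ᶜ : Set Mt) := lt_of_lt_of_le (by norm_num) h
  obtain ⟨⟨d, f, hf, hd, hU⟩, hlt⟩ := lt_iSup_iff.1 h1
  have hd2 : 1 < d := by exact_mod_cast hlt
  have hsub : ∀ i, f i ⊆ {x}ᶜ := fun i => hU ▸ subset_iUnion f i
  have hop : ∀ S : Set Mt, S ⊆ {x}ᶜ → IsOpen ((Subtype.val : ({x}ᶜ : Set Mt) → Mt) ⁻¹' S) →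
      IsOpen S := by
    intro S hS ho
    have := isOpen_compl_singleton.isOpenMap_subtype_val _ ho
    rwa [Subtype.image_preimage_coe, inter_eq_right.2 hS] at this
  refine ⟨f ⟨0, by omega⟩, (hf _).2.1, fun hx => hsub _ hx rfl, hop _ (hsub _) (hf _).2.2.2,
    hop _ sdiff_subset ?_, (hf _).1, ?_⟩
  · rw [preimage_sdiff, Subtype.coe_preimage_self, ← compl_eq_univ_sdiff]
    exact (hf _).2.2.compl.isOpen
  · obtain ⟨b, hb⟩ := (hf ⟨1, hd2⟩).1
    refine ⟨b, hsub _ hb, fun hb0 => ?_⟩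
    exact disjoint_left.1 (hd (show (⟨0, by omega⟩ : Fin d) ≠ ⟨1, hd2⟩ by simp)) hb0 hb

/-- The member with parameters `z` of the family of sets of points defined by a formula. -/
def famSet {L : FirstOrder.Language.{w, w'}} {Mt : Type u} {Mb : Type v} [L.Structure (Mt ⊕ Mb)]
    (i : Σ m, L.Formula (Fin m ⊕ Unit)) (z : Fin i.1 → Mt ⊕ Mb) : Set Mt :=
  {y | i.2.Realize (Sum.elim z (fun _ => Sum.inl y))}

variable [Tame L Mt Mb]

theorem dp_famSet {A : Set (Mt ⊕ Mb)} (i : Σ m, L.Formula (Fin m ⊕ Unit)) :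
    DP L A (fun p : (Fin i.1 → Mt ⊕ Mb) × Mt => p.2 ∈ famSet i p.1) :=
  (DP.realize i.2).comp (DMap.id.fst.pair (DMap.inl.comp DMap.id.snd))

theorem dp_cuts_famSet {A : Set (Mt ⊕ Mb)} (i : Σ m, L.Formula (Fin m ⊕ Unit)) :
    DP L A (fun p : Mt × (Fin i.1 → Mt ⊕ Mb) => Cuts p.1 (famSet i p.2)) := by
  unfold Cuts
  have hU : DP L A (fun p : (Mt × (Fin i.1 → Mt ⊕ Mb)) × Mt => p.2 ∈ famSet i p.1.2) :=
    (dp_famSet i).comp (DMap.id.fst.snd.pair DMap.id.snd)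
  have hV : DP L A (fun p : (Mt × (Fin i.1 → Mt ⊕ Mb)) × Mt =>
      p.2 ∈ ({p.1.1}ᶜ \ famSet i p.1.2 : Set Mt)) :=
    (DP.eq DMap.id.snd DMap.id.fst.fst).not.and hU.not
  refine DP.and ?_ (DP.and ?_ (DP.and ?_ (DP.and ?_ ?_)))
  · exact ((dp_famSet i).comp (DMap.id.snd.pair DMap.id.fst)).not
  · exact dp_isOpen (P := fun (p : Mt × (Fin i.1 → Mt ⊕ Mb)) y => y ∈ famSet i p.2) hU
  · exact dp_isOpen (P := fun (p : Mt × (Fin i.1 → Mt ⊕ Mb)) y =>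
      y ∈ ({p.1}ᶜ \ famSet i p.2 : Set Mt)) hV
  · exact DP.ex (P := fun (p : Mt × (Fin i.1 → Mt ⊕ Mb)) y => y ∈ famSet i p.2) hU
  · exact DP.ex (P := fun (p : Mt × (Fin i.1 → Mt ⊕ Mb)) y =>
      y ∈ ({p.1}ᶜ \ famSet i p.2 : Set Mt)) hV

theorem exists_formula_of_dp {P : Mt → Prop} (hP : DP L (∅ : Set (Mt ⊕ Mb)) P)
    (a : Fin 0 → Mt ⊕ Mb) : ∃ ψ : L.Formula (Fin 0 ⊕ Unit), ∀ x : Mt ⊕ Mb,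
      ψ.Realize (Sum.elim a (fun _ => x)) ↔ ∃ y, x = Sum.inl y ∧ P y := by
  obtain ⟨φ, hφ⟩ := empty_definable_iff.1 hP
  refine ⟨φ.relabel (fun _ => Sum.inr ()), fun x => ?_⟩
  rw [Formula.realize_relabel]
  have h1 : φ.Realize (Sum.elim a (fun _ => x) ∘ fun _ => Sum.inr ()) ↔
      (fun _ : Ctx.ι L (Mt ⊕ Mb) Mt => x) ∈ Ctx.enc (L := L) (N := Mt ⊕ Mb) '' {g | P g} := by
    rw [hφ]
    rfl
  rw [h1]
  constructor
  · rintro ⟨y, hy, hyx⟩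
    exact ⟨y, (congrFun hyx (0 : Fin 1)).symm, hy⟩
  · rintro ⟨y, rfl, hy⟩
    exact ⟨y, hy, rfl⟩

/-- By saturation, finitely many formulas suffice to cut the space at every point. -/
theorem exists_finset_cuts (hsat : IsOmegaSaturated L (Mt ⊕ Mb))
    (hcut : ∀ x : Mt, ∃ U : Set Mt, Dfn L Mb U ∧ Cuts x U) :
    ∃ F : Finset (Σ m, L.Formula (Fin m ⊕ Unit)), ∀ x : Mt, ∃ i ∈ F,
      ∃ z : Fin i.1 → Mt ⊕ Mb, Cuts x (famSet i z) := by
  classical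
  by_contra! hcon
  let a : Fin 0 → Mt ⊕ Mb := Fin.elim0
  have hD : ∀ i : Σ m, L.Formula (Fin m ⊕ Unit),
      DP L (∅ : Set (Mt ⊕ Mb)) (fun x : Mt => ¬ ∃ z : Fin i.1 → Mt ⊕ Mb, Cuts x (famSet i z)) := fun i =>
    (DP.ex (P := fun x z => Cuts x (famSet i z)) (dp_cuts_famSet i)).not
  choose ψ hψ using fun i => exists_formula_of_dp (hD i) a
  -- The type realized here says of a point that no formula whatsoever cuts the space at it.
  obtain ⟨x, hx⟩ := hsat 0 a (range ψ) (by
    intro q hq hqf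
    obtain ⟨F, hF⟩ := hqf.exists_finset_coe
    have : ∀ χ ∈ q, ∃ i, ψ i = χ := fun χ hχ => hq hχ
    choose! g hg using this
    obtain ⟨x, hx⟩ := hcon (F.image g)
    refine ⟨Sum.inl x, fun χ hχ => ?_⟩
    rw [← hg χ hχ, hψ]
    refine ⟨x, rfl, ?_⟩
    rintro ⟨z, hz⟩
    exact hx (g χ) (Finset.mem_image_of_mem g (by rw [← hF] at hχ; exact hχ)) z hz)
  -- The choice of formula is irrelevant: any member of the type forces the realization to be of the
  -- sort of points.
  obtain ⟨y, rfl, -⟩ := (hψ ⟨0, ⊥⟩ x).1 (hx _ (mem_range_self _))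
  obtain ⟨U, hU, hyU⟩ := hcut y
  obtain ⟨m, χ, z, rfl⟩ := dfn_iff_exists_formula.1 hU
  obtain ⟨y', hyy', hy'⟩ := (hψ ⟨m, χ⟩ (Sum.inl y)).1 (hx _ (mem_range_self _))
  obtain rfl := Sum.inl_injective hyy'
  exact hy' ⟨z, hyU⟩

/-- A definable family of equivalence relations, the one with index `x` having at least two classes
in `{x}ᶜ`, all of which are open. -/
structure CutRel (L : FirstOrder.Language.{w, w'}) {Mt : Type u} (Mb : Type v)
    [L.Structure (Mt ⊕ Mb)] [TopologicalSpace Mt] [Tame L Mt Mb] (E : Mt → Mt → Mt → Prop) :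
    Prop where
  dp : DP L (univ : Set (Mt ⊕ Mb)) (fun p : Mt × Mt × Mt => E p.1 p.2.1 p.2.2)
  refl : ∀ {x a}, a ≠ x → E x a a
  symm : ∀ {x a b}, E x a b → E x b a
  trans : ∀ {x a b c}, E x a b → E x b c → E x a c
  isOpen : ∀ {x a}, a ≠ x → IsOpen {b | b ≠ x ∧ E x a b}
  exists_not : ∀ x, ∃ a b, a ≠ x ∧ b ≠ x ∧ ¬ E x a b

/-- Two points are related at `x` when they lie on the same side of every cut at `x` from the finite
list. Quantifying over all parameters avoids any definable choice of a cut. -/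
theorem exists_cutRel [T2Space Mt] (hsat : IsOmegaSaturated L (Mt ⊕ Mb))
    (hcut : ∀ x : Mt, ∃ U : Set Mt, Dfn L Mb U ∧ Cuts x U) :
    ∃ E : Mt → Mt → Mt → Prop, CutRel L Mb E := by
  obtain ⟨F, hF⟩ := exists_finset_cuts hsat hcut
  refine ⟨fun x a b => ∀ i ∈ F, ∀ z : Fin i.1 → Mt ⊕ Mb, Cuts x (famSet i z) → (a ∈ famSet i z ↔ b ∈ famSet i z),
    ?_, ?_, ?_, ?_, ?_, ?_⟩
  · refine DP.forall_finset F fun i => DP.all (DP.imp ?_ (DP.iff ?_ ?_))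
    · exact (dp_cuts_famSet i).comp (DMap.id.fst.fst.pair DMap.id.snd)
    · exact (dp_famSet i).comp (DMap.id.snd.pair DMap.id.fst.snd.fst)
    · exact (dp_famSet i).comp (DMap.id.snd.pair DMap.id.fst.snd.snd)
  · exact fun _ i _ z _ => Iff.rfl
  · exact fun h i hi z hz => (h i hi z hz).symm
  · exact fun h h' i hi z hz => (h i hi z hz).trans (h' i hi z hz)
  · intro x a hax
    rw [isOpen_iff_mem_nhds]
    rintro b ⟨hbx, hb⟩
    -- A connected neighbourhood of `b` omitting `x` lies on one side of each of the possibly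
    -- infinitely many cuts at `x`.
    obtain ⟨K, -, hKo, hK, hbK, hKx⟩ :=
      exists_preconnected_nhd L Mb (isOpen_compl_singleton (x := x)) hbx
    refine Filter.mem_of_superset (hKo.mem_nhds hbK) fun c hc => ⟨hKx hc, fun i hi z hz => ?_⟩
    rw [hb i hi z hz]
    rcases hK (famSet i z) (dfn_iff_dp.2 ((dp_famSet i).comp ((DMap.const z).pair DMap.id)))
      (disjoint_left.2 fun y hy hyf => hKx hy (hz.frontier_subset hyf)) with h | h
    · exact iff_of_true (h hbK) (h hc)
    · exact iff_of_false (disjoint_left.1 h hbK) (disjoint_left.1 h hc)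
  · intro x
    obtain ⟨i, hi, z, hz⟩ := hF x
    obtain ⟨a, ha⟩ := hz.2.2.2.1
    obtain ⟨b, hb⟩ := hz.2.2.2.2
    refine ⟨a, b, ?_, hb.1, fun h => hb.2 ((h i hi z hz).1 ha)⟩
    rintro rfl
    exact hz.1 ha

end Saturation

/-! ### The tree order seen from a base point. -/

section Tree

variable {L : FirstOrder.Language.{w, w'}} {Mt : Type u} {Mb : Type v} [L.Structure (Mt ⊕ Mb)]
  [TopologicalSpace Mt] [Tame L Mt Mb]

/-- The class of `p` in the complement of `x`. -/
def Near (E : Mt → Mt → Mt → Prop) (p x : Mt) : Set Mt := {y | y ≠ x ∧ E x p y}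

/-- The points separated by `x` from `p`. -/
def Far (E : Mt → Mt → Mt → Prop) (p x : Mt) : Set Mt := {y | y ≠ x ∧ ¬ E x p y}

/-- The point `x` separates `a` from `b`. -/
def Sep (E : Mt → Mt → Mt → Prop) (x a b : Mt) : Prop := x ≠ a ∧ x ≠ b ∧ ¬ E x a b

/-- The points separated from `p` by some element of `T`. -/
def UpSet (E : Mt → Mt → Mt → Prop) (p : Mt) (T : Set Mt) : Set Mt := {y | ∃ x, x ∈ T ∧ y ∈ Far E p x}

omit [L.Structure (Mt ⊕ Mb)] [Tame L Mt Mb] in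
theorem frontier_subset_singleton {A B : Set Mt} {x : Mt} (hA : IsOpen A) (hB : IsOpen B)
    (hdj : Disjoint A B) (h : ∀ y, y ≠ x → y ∈ A ∨ y ∈ B) : frontier A ⊆ {x} := by
  intro y hy
  by_contra hyx
  rw [hA.frontier_eq] at hy
  obtain ⟨z, hz, hzA⟩ := mem_closure_iff.1 hy.1 _ hB ((h y hyx).resolve_left hy.2)
  exact disjoint_left.1 hdj hzA hz

theorem interior_nonempty_of_infinite {S : Set Mt} (hS : Dfn L Mb S) (h : S.Infinite) :
    (interior S).Nonempty := by
  rw [nonempty_iff_ne_empty]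
  exact fun h0 => h (finite_of_interior_eq_empty hS h0)

omit [TopologicalSpace Mt] in
theorem disjoint_near_far {E : Mt → Mt → Mt → Prop} {p x : Mt} :
    Disjoint (Near E p x) (Far E p x) :=
  disjoint_left.2 fun _ h h' => h'.2 h.2

namespace CutRel

variable {E : Mt → Mt → Mt → Prop} (hE : CutRel L Mb E) {p x y z a b c : Mt}
include hE

theorem dp_rel {Γ : Type*} [Ctx L (Mt ⊕ Mb) Γ] {f g h : Γ → Mt} (hf : DMap L (univ : Set (Mt ⊕ Mb)) f)
    (hg : DMap L (univ : Set (Mt ⊕ Mb)) g) (hh : DMap L (univ : Set (Mt ⊕ Mb)) h) :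
    DP L (univ : Set (Mt ⊕ Mb)) (fun t => E (f t) (g t) (h t)) :=
  hE.dp.comp (hf.pair (hg.pair hh))

theorem dp_near {Γ : Type*} [Ctx L (Mt ⊕ Mb) Γ] {f g h : Γ → Mt} (hf : DMap L (univ : Set (Mt ⊕ Mb)) f)
    (hg : DMap L (univ : Set (Mt ⊕ Mb)) g) (hh : DMap L (univ : Set (Mt ⊕ Mb)) h) :
    DP L (univ : Set (Mt ⊕ Mb)) (fun t => h t ∈ Near E (f t) (g t)) :=
  (DP.eq hh hg).not.and (hE.dp_rel hg hf hh)

theorem dp_far {Γ : Type*} [Ctx L (Mt ⊕ Mb) Γ] {f g h : Γ → Mt} (hf : DMap L (univ : Set (Mt ⊕ Mb)) f)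
    (hg : DMap L (univ : Set (Mt ⊕ Mb)) g) (hh : DMap L (univ : Set (Mt ⊕ Mb)) h) :
    DP L (univ : Set (Mt ⊕ Mb)) (fun t => h t ∈ Far E (f t) (g t)) :=
  (DP.eq hh hg).not.and (hE.dp_rel hg hf hh).not

theorem dp_sep {Γ : Type*} [Ctx L (Mt ⊕ Mb) Γ] {f g h : Γ → Mt} (hf : DMap L (univ : Set (Mt ⊕ Mb)) f)
    (hg : DMap L (univ : Set (Mt ⊕ Mb)) g) (hh : DMap L (univ : Set (Mt ⊕ Mb)) h) :
    DP L (univ : Set (Mt ⊕ Mb)) (fun t => Sep E (f t) (g t) (h t)) :=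
  (DP.eq hf hg).not.and ((DP.eq hf hh).not.and (hE.dp_rel hf hg hh).not)

theorem dfn_near : Dfn L Mb (Near E p x) :=
  dfn_iff_dp.2 (hE.dp_near (DMap.const p) (DMap.const x) DMap.id)

theorem dfn_far : Dfn L Mb (Far E p x) :=
  dfn_iff_dp.2 (hE.dp_far (DMap.const p) (DMap.const x) DMap.id)

theorem dfn_sep : Dfn L Mb {x | Sep E x a b} :=
  dfn_iff_dp.2 (hE.dp_sep DMap.id (DMap.const a) (DMap.const b))

theorem dfn_upSet {T : Set Mt} (hT : Dfn L Mb T) : Dfn L Mb (UpSet E p T) :=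
  dfn_iff_dp.2 (DP.ex (P := fun y x => x ∈ T ∧ y ∈ Far E p x) (DP.and
    ((dfn_iff_dp.1 hT).comp DMap.id.snd) (hE.dp_far (DMap.const p) DMap.id.snd DMap.id.fst)))

theorem isOpen_near (h : p ≠ x) : IsOpen (Near E p x) := hE.isOpen h

theorem isOpen_far : IsOpen (Far E p x) := by
  rw [isOpen_iff_mem_nhds]
  rintro y ⟨hyx, hy⟩
  refine Filter.mem_of_superset ((hE.isOpen hyx).mem_nhds ⟨hyx, hE.refl hyx⟩) ?_
  rintro b ⟨hbx, hb⟩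
  exact ⟨hbx, fun h => hy (hE.trans h (hE.symm hb))⟩

theorem frontier_near (h : p ≠ x) : frontier (Near E p x) ⊆ {x} :=
  frontier_subset_singleton (hE.isOpen_near h) hE.isOpen_far disjoint_near_far fun y hy => by
    by_cases hyE : E x p y
    · exact Or.inl ⟨hy, hyE⟩
    · exact Or.inr ⟨hy, hyE⟩

theorem frontier_far (h : p ≠ x) : frontier (Far E p x) ⊆ {x} :=
  frontier_subset_singleton hE.isOpen_far (hE.isOpen_near h) disjoint_near_far.symm
    fun y hy => by
      by_cases hyE : E x p y
      · exact Or.inr ⟨hy, hyE⟩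
      · exact Or.inl ⟨hy, hyE⟩

/-- Points in a preconnected set are not separated by points outside it. -/
theorem of_preconnected {K : Set Mt} (hK : PC L Mb K) (hx : x ∉ K) (ha : a ∈ K) (hb : b ∈ K) :
    E x a b := by
  have hax : a ≠ x := fun h => hx (h ▸ ha)
  exact (hK.subset_of_mem hE.dfn_near
    (disjoint_left.2 fun y hy hyf => hx (hE.frontier_near hax hyf ▸ hy)) ha
    (⟨hax, hE.refl hax⟩ : a ∈ Near E a x) hb).2

theorem preconnected_insert_near (h : p ≠ x) : PC L Mb (insert x (Near E p x)) :=
  preconnected_insert hE.dfn_near (fun h => h.1 rfl) (hE.frontier_near h)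

theorem preconnected_insert_far (h : p ≠ x) : PC L Mb (insert x (Far E p x)) :=
  preconnected_insert hE.dfn_far (fun h => h.1 rfl) (hE.frontier_far h)

theorem mem_near_self (h : p ≠ x) : p ∈ Near E p x := ⟨h, hE.refl h⟩

theorem ne_of_mem_far (h : p ≠ x) (hy : y ∈ Far E p x) : y ≠ p := by
  rintro rfl
  exact hy.2 (hE.refl h)

theorem far_nonempty : (Far E p x).Nonempty := by
  obtain ⟨a, b, ha, hb, hab⟩ := hE.exists_not x
  by_cases h : E x p a
  · exact ⟨b, hb, fun h' => hab (hE.trans (hE.symm h) h')⟩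
  · exact ⟨a, ha, h⟩

/-- Only `x` can be a frontier point of the class, and an empty frontier would make the class the
whole space. -/
theorem mem_closure_near (h : p ≠ x) : x ∈ closure (Near E p x) := by
  have hne : (frontier (Near E p x)).Nonempty := by
    rw [nonempty_iff_ne_empty]
    intro h0
    have := eq_univ_of_frontier_eq_empty hE.dfn_near h0 ⟨p, hE.mem_near_self h⟩
    exact (this ▸ mem_univ x : x ∈ Near E p x).1 rfl
  obtain ⟨y, hy⟩ := hne
  obtain rfl : y = x := hE.frontier_near h hy
  exact hy.1

theorem exists_mem_ne {U : Set Mt} (hU : IsOpen U) (hx : x ∈ U) : ∃ y ∈ U, y ≠ x := by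
  obtain ⟨a, b, ha, hb, hab⟩ := hE.exists_not x
  obtain ⟨y, hy, hyn⟩ := mem_closure_iff.1 (hE.mem_closure_near ha) U hU hx
  exact ⟨y, hy, hyn.1⟩

theorem not_mem_interior_of_finite [T2Space Mt] {S : Set Mt} (hS : S.Finite) :
    x ∉ interior S := by
  intro hx
  obtain ⟨y, hy, hyx⟩ := hE.exists_mem_ne (isOpen_interior.sdiff
    ((hS.subset sdiff_subset : (S \ {x}).Finite).isClosed)) ⟨hx, fun h => h.2 rfl⟩
  exact hy.2 ⟨interior_subset hy.1, hyx⟩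

/-- The class of `p` at `x` together with `x` is connected, joins `p` to `x` and avoids `y`. -/
theorem not_mem_far_of_mem_far (hpx : p ≠ x) (hy : y ∈ Far E p x) : x ∉ Far E p y := fun h =>
  h.2 (hE.of_preconnected (hE.preconnected_insert_near hpx)
    (fun h' => h'.elim hy.1 fun h' => hy.2 h'.2) (mem_insert_of_mem _ (hE.mem_near_self hpx))
    (mem_insert _ _))

theorem insert_far_subset (hpx : p ≠ x) (hy : y ∈ Far E p x) : insert y (Far E p y) ⊆ Far E p x := by
  refine insert_subset hy fun z hz => ⟨?_, fun h => ?_⟩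
  · rintro rfl
    exact hE.not_mem_far_of_mem_far hpx hy hz
  · by_cases hzx : z = x
    · exact hE.not_mem_far_of_mem_far hpx hy (hzx ▸ hz)
    · exact hz.2 (hE.of_preconnected (hE.preconnected_insert_near hpx)
        (fun h' => h'.elim hy.1 fun h' => hy.2 h'.2)
        (mem_insert_of_mem _ (hE.mem_near_self hpx)) (mem_insert_of_mem _ ⟨hzx, h⟩))

theorem far_subset (hpx : p ≠ x) (hy : y ∈ Far E p x) : Far E p y ⊆ Far E p x :=
  (subset_insert _ _).trans (hE.insert_far_subset hpx hy)

/-- The tree property: points separating `p` from a common `c` form a chain. If `y` is not beyond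
`x`, it cannot separate `x` from `c`; if moreover `x` is not beyond `y`, then `y` cannot separate
`p` from `c`. -/
theorem comparable (hpx : p ≠ x) (hcx : c ∈ Far E p x) (hcy : c ∈ Far E p y)
    (hxy : x ≠ y) : y ∈ Far E p x ∨ x ∈ Far E p y := by
  by_contra! h
  have h1 : E y p x := by
    by_contra hn
    exact h.2 ⟨hxy, hn⟩
  exact hcy.2 (hE.trans h1 (hE.of_preconnected (hE.preconnected_insert_far hpx)
    (fun h' => h'.elim (fun h' => hxy h'.symm) h.1) (mem_insert _ _) (mem_insert_of_mem _ hcx)))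

theorem isOpen_upSet {T : Set Mt} : IsOpen (UpSet E p T) := by
  have : UpSet E p T = ⋃ x ∈ T, Far E p x := by
    ext y
    simp [UpSet]
  rw [this]
  exact isOpen_biUnion fun x _ => hE.isOpen_far

/-! ### Chains `T` of separators of `p` from `c`; `hmin` says that none of them is closest to `p`.
-/

section Chain

variable {T : Set Mt} (hT : Dfn L Mb T) (hTc : ∀ x ∈ T, p ≠ x ∧ c ∈ Far E p x)
  (hmin : ∀ x ∈ T, ∃ y ∈ T, x ∈ Far E p y) (hne : T.Nonempty)

include hTc hmin in
theorem preconnected_upSet : PC L Mb (UpSet E p T) := by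
  have : UpSet E p T = ⋃₀ ((fun x => insert x (Far E p x)) '' T) := by
    ext y
    simp only [UpSet, mem_sUnion, mem_image, exists_exists_and_eq_and]
    constructor
    · rintro ⟨x, hx, hy⟩
      exact ⟨x, hx, mem_insert_of_mem _ hy⟩
    · rintro ⟨x, hx, hy⟩
      obtain ⟨t, ht, hxt⟩ := hmin x hx
      exact ⟨t, ht, hE.insert_far_subset (hTc t ht).1 hxt hy⟩
  rw [this]
  refine PC.sUnion (c := c) ?_
  rintro _ ⟨x, hx, rfl⟩
  exact ⟨hE.preconnected_insert_far (hTc x hx).1, mem_insert_of_mem _ (hTc x hx).2⟩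

include hTc in
theorem notMem_upSet : p ∉ UpSet E p T := fun ⟨x, hx, hp⟩ => hE.ne_of_mem_far (hTc x hx).1 hp rfl

-- The frontier point plays the role of the infimum of `T`. Two of them would have disjoint
-- connected neighbourhoods, both meeting `Far E p t` for a common `t ∈ T` because `T` is a chain.
-- Each neighbourhood also has a point outside `Far E p t`, so both would contain `t`.
include hT hTc hne in
theorem frontier_upSet [T2Space Mt] : ∃ m, frontier (UpSet E p T) = {m} := by
  obtain ⟨x₀, hx₀⟩ := hne
  have hfne : (frontier (UpSet E p T)).Nonempty := by
    rw [nonempty_iff_ne_empty]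
    intro h0
    have := eq_univ_of_frontier_eq_empty (hE.dfn_upSet hT) h0 ⟨c, x₀, hx₀, (hTc x₀ hx₀).2⟩
    exact hE.notMem_upSet hTc (this ▸ mem_univ p)
  obtain ⟨m, hm⟩ := hfne
  refine ⟨m, subset_antisymm (fun m' hm' => ?_) (singleton_subset_iff.2 hm)⟩
  by_contra hne
  rw [hE.isOpen_upSet.frontier_eq] at hm hm'
  obtain ⟨U, V, hU, hV, hmU, hmV, hUV⟩ := t2_separation (show m' ≠ m from hne)
  obtain ⟨O, -, hOo, hO, hmO, hOU⟩ := exists_preconnected_nhd L Mb hU hmU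
  obtain ⟨O', -, hO'o, hO', hmO', hOV⟩ := exists_preconnected_nhd L Mb hV hmV
  obtain ⟨y, hyO, x, hxT, hyx⟩ := mem_closure_iff.1 hm'.1 O hOo hmO
  obtain ⟨y', hyO', x', hxT', hyx'⟩ := mem_closure_iff.1 hm.1 O' hO'o hmO'
  have key : ∀ {x y n : Mt} {O : Set Mt}, PC L Mb O → n ∈ O → n ∉ UpSet E p T → x ∈ T →
      y ∈ O → y ∈ Far E p x → x ∈ O := by
    intro x y n O hO hn hnV hx hy hyx
    by_contra hxO
    exact hnV ⟨x, hx, hO.subset_of_mem hE.dfn_far (disjoint_left.2 fun z hz hzf =>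
      hxO (hE.frontier_far (hTc x hx).1 hzf ▸ hz)) hy hyx hn⟩
  have hcommon : ∃ t ∈ T, y ∈ Far E p t ∧ y' ∈ Far E p t := by
    by_cases hxx : x = x'
    · exact ⟨x, hxT, hyx, hxx ▸ hyx'⟩
    rcases hE.comparable (hTc x hxT).1 (hTc x hxT).2 (hTc x' hxT').2 hxx with h | h
    · exact ⟨x, hxT, hyx, hE.far_subset (hTc x hxT).1 h hyx'⟩
    · exact ⟨x', hxT', hE.far_subset (hTc x' hxT').1 h hyx, hyx'⟩
  obtain ⟨t, ht, hyt, hyt'⟩ := hcommon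
  exact disjoint_left.1 hUV (hOU (key hO hmO hm'.2 ht hyO hyt))
    (hOV (key hO' hmO' hm.2 ht hyO' hyt'))

include hTc hmin in
theorem preconnected_insert_upSet {m : Mt} (hm : m ∈ frontier (UpSet E p T)) :
    PC L Mb (insert m (UpSet E p T)) :=
  (hE.preconnected_upSet hTc hmin).subset_closure (subset_insert _ _)
    (insert_subset hm.1 subset_closure)

include hTc hmin in
theorem upSet_subset_far {m : Mt} (hm : m ∈ frontier (UpSet E p T)) (hmz : m ∈ Far E p z) :
    UpSet E p T ⊆ Far E p z := by
  have hmV : m ∉ UpSet E p T := by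
    rw [hE.isOpen_upSet.frontier_eq] at hm
    exact hm.2
  have hzV : z ∉ UpSet E p T := fun ⟨x, hx, hz⟩ =>
    hmV ⟨x, hx, hE.far_subset (hTc x hx).1 hz hmz⟩
  intro y hy
  refine ⟨fun h => hzV (h ▸ hy), fun h => hmz.2 (hE.trans h ?_)⟩
  exact hE.of_preconnected (hE.preconnected_insert_upSet hTc hmin hm)
    (fun h' => h'.elim (fun h' => hmz.1 h'.symm) hzV) (mem_insert_of_mem _ hy) (mem_insert _ _)

end Chain

end CutRel

end Tree

/-! ### Separating any two points, and refinement to connected classes. -/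

section Link

variable {L : FirstOrder.Language.{w, w'}} {Mt : Type u} {Mb : Type v} [L.Structure (Mt ⊕ Mb)]
  [TopologicalSpace Mt] [Tame L Mt Mb]

/-- Some point separates both `a` and `b` from `p`. -/
def Link (E : Mt → Mt → Mt → Prop) (p a b : Mt) : Prop := ∃ x, p ≠ x ∧ a ∈ Far E p x ∧ b ∈ Far E p x

/-- The points which no point separates from `p`. -/
def Unsep (E : Mt → Mt → Mt → Prop) (p : Mt) : Set Mt := {z | ∀ c, p ≠ c → z ≠ c → E c p z}

omit [TopologicalSpace Mt] in
theorem notMem_unsep {E : Mt → Mt → Mt → Prop} {p x y : Mt} (h : p ≠ x) (hy : y ∈ Far E p x) :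
    y ∉ Unsep E p := fun hz => hy.2 (hz x h hy.1)

omit [TopologicalSpace Mt] in
theorem exists_of_notMem_unsep {E : Mt → Mt → Mt → Prop} {p y : Mt} (hy : y ∉ Unsep E p) :
    ∃ x, p ≠ x ∧ y ∈ Far E p x := by
  by_contra! h
  exact hy fun c hpc hyc => by_contra fun hn => h c hpc ⟨hyc, hn⟩

namespace CutRel

variable {E : Mt → Mt → Mt → Prop} (hE : CutRel L Mb E) {p x y z a b c : Mt}
include hE

theorem dp_link {Γ : Type*} [Ctx L (Mt ⊕ Mb) Γ] {f g h : Γ → Mt}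
    (hf : DMap L (univ : Set (Mt ⊕ Mb)) f)
    (hg : DMap L (univ : Set (Mt ⊕ Mb)) g) (hh : DMap L (univ : Set (Mt ⊕ Mb)) h) :
    DP L (univ : Set (Mt ⊕ Mb)) (fun t => Link E (f t) (g t) (h t)) := by
  have : DP L (univ : Set (Mt ⊕ Mb)) (fun t : Mt × Mt × Mt => Link E t.1 t.2.1 t.2.2) :=
    DP.ex (P := fun (t : Mt × Mt × Mt) (x : Mt) => t.1 ≠ x ∧ t.2.1 ∈ Far E t.1 x ∧ t.2.2 ∈ Far E t.1 x)
    ((DP.eq DMap.id.fst.fst DMap.id.snd).not.and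
      ((hE.dp_far DMap.id.fst.fst DMap.id.snd DMap.id.fst.snd.fst).and
        (hE.dp_far DMap.id.fst.fst DMap.id.snd DMap.id.fst.snd.snd)))
  exact this.comp (hf.pair (hg.pair hh))

theorem dfn_link : Dfn L Mb {y | Link E p a y} :=
  dfn_iff_dp.2 (hE.dp_link (DMap.const p) (DMap.const a) DMap.id)

theorem dfn_separators : Dfn L Mb {x | p ≠ x ∧ c ∈ Far E p x} :=
  dfn_iff_dp.2 ((DP.eq (DMap.const p) DMap.id).not.and
    (hE.dp_far (DMap.const p) DMap.id (DMap.const c)))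

omit hE [TopologicalSpace Mt] in
theorem setOf_link : {y | Link E p c y} = UpSet E p {x | p ≠ x ∧ c ∈ Far E p x} := by
  ext y
  constructor
  · rintro ⟨x, hx, hc, hy⟩
    exact ⟨x, ⟨hx, hc⟩, hy⟩
  · rintro ⟨x, ⟨hx, hc⟩, hy⟩
    exact ⟨x, hx, hc, hy⟩

theorem isOpen_link : IsOpen {y | Link E p c y} := by
  rw [setOf_link]
  exact hE.isOpen_upSet

omit hE [TopologicalSpace Mt] in
theorem _root_.TTT.Link.symm (h : Link E p a b) : Link E p b a :=
  let ⟨x, hx, ha, hb⟩ := h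
  ⟨x, hx, hb, ha⟩

theorem link_trans (h : Link E p a b) (h' : Link E p b c) : Link E p a c := by
  obtain ⟨x, hx, ha, hb⟩ := h
  obtain ⟨y, hy, hb', hc⟩ := h'
  by_cases hxy : x = y
  · exact ⟨x, hx, ha, hxy ▸ hc⟩
  rcases hE.comparable hx hb hb' hxy with h | h
  · exact ⟨x, hx, ha, hE.far_subset hx h hc⟩
  · exact ⟨y, hy, hE.far_subset hy h ha, hc⟩

theorem ne_of_link (h : Link E p a b) : b ≠ p :=
  let ⟨_, hx, _, hb⟩ := h
  hE.ne_of_mem_far hx hb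

/-- Any `z ≠ p` is a limit of points that `z` itself separates from `p`, so the interior is
contained in `{p}`; as there are no isolated points, it is empty. -/
theorem finite_unsep [T2Space Mt] : (Unsep E p).Finite := by
  have hZ : Dfn L Mb (Unsep E p) := dfn_iff_dp.2 (DP.all
    (P := fun z c => p ≠ c → z ≠ c → E c p z)
    ((DP.eq (DMap.const p) DMap.id.snd).not.imp ((DP.eq DMap.id.fst DMap.id.snd).not.imp
      (hE.dp_rel DMap.id.snd (DMap.const p) DMap.id.fst))))
  refine finite_of_interior_eq_empty hZ (eq_empty_iff_forall_notMem.2 fun z hz => ?_)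
  have key : interior (Unsep E p) ⊆ {p} := by
    intro z hz
    by_contra hzp
    obtain ⟨y, hy⟩ := hE.far_nonempty (p := p) (x := z)
    obtain ⟨t, ht, hty⟩ :=
      mem_closure_iff.1 (hE.mem_closure_near hy.1) _ isOpen_interior hz
    exact notMem_unsep (Ne.symm hzp) (⟨hty.1, fun h => hy.2 (hE.trans h (hE.symm hty.2))⟩ :
      t ∈ Far E p z) (interior_subset ht)
  refine hE.not_mem_interior_of_finite ((finite_singleton p).subset key) (x := z) ?_
  rwa [interior_interior]

theorem frontier_far_eq (h : p ≠ x) : frontier (Far E p x) = {x} := by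
  refine (subset_singleton_iff_eq.1 (hE.frontier_far h)).resolve_left fun h0 => ?_
  have := eq_univ_of_frontier_eq_empty hE.dfn_far h0 hE.far_nonempty
  exact (this ▸ mem_univ x : x ∈ Far E p x).1 rfl

/-- The point `m` is the infimum of the separators of `p` from `c`, attained or not. A point
separating `p` from `m` would be a separator of `c` below that infimum. -/
theorem frontier_link [T2Space Mt] (hc : c ∉ Unsep E p) :
    ∃ m ∈ Unsep E p, frontier {y | Link E p c y} = {m} := by
  rw [setOf_link]
  set T := {x | p ≠ x ∧ c ∈ Far E p x} with hT
  have hTc : ∀ x ∈ T, p ≠ x ∧ c ∈ Far E p x := fun x hx => hx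
  by_cases hmin : ∀ x ∈ T, ∃ y ∈ T, x ∈ Far E p y
  · obtain ⟨m, hm⟩ := hE.frontier_upSet hE.dfn_separators hTc (exists_of_notMem_unsep hc)
    refine ⟨m, ?_, hm⟩
    by_contra hmZ
    obtain ⟨z, hpz, hmz⟩ := exists_of_notMem_unsep hmZ
    have hsub := hE.upSet_subset_far hTc hmin (hm ▸ mem_singleton m) hmz
    obtain ⟨x, hx⟩ := exists_of_notMem_unsep hc
    have hcz : c ∈ Far E p z := hsub ⟨x, hx, hx.2⟩
    obtain ⟨y, hy, hzy⟩ := hmin z ⟨hpz, hcz⟩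
    exact (hsub ⟨y, hy, hzy⟩).1 rfl
  · push Not at hmin
    obtain ⟨t, ht, htmin⟩ := hmin
    have hU : UpSet E p T = Far E p t := by
      refine subset_antisymm ?_ fun y hy => ⟨t, ht, hy⟩
      rintro y ⟨x, hx, hy⟩
      by_cases hxt : x = t
      · exact hxt ▸ hy
      · exact hE.far_subset ht.1
          ((hE.comparable hx.1 hx.2 ht.2 hxt).resolve_left (htmin x hx)) hy
    refine ⟨t, ?_, by rw [hU, hE.frontier_far_eq ht.1]⟩
    by_contra htZ
    obtain ⟨z, hpz, htz⟩ := exists_of_notMem_unsep htZ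
    exact htmin z ⟨hpz, hE.far_subset hpz htz ht.2⟩ htz

/-- A connected neighbourhood whose only unseparated point is `m` works: the link class of `c`
contains `c` but not `m`, so its unique frontier point lies in the neighbourhood. -/
theorem exists_nhd_unsep [T2Space Mt] {m : Mt} (hm : m ∈ Unsep E p) :
    ∃ O : Set Mt, Dfn L Mb O ∧ IsOpen O ∧ m ∈ O ∧
      ∀ c ∈ O, c ≠ m → c ∉ Unsep E p ∧ frontier {y | Link E p c y} = {m} := by
  have ho : IsOpen (Unsep E p \ {m})ᶜ :=
    (hE.finite_unsep.subset sdiff_subset).isClosed.isOpen_compl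
  obtain ⟨O, hO, hOo, hOpc, hmO, hsub⟩ :=
    exists_preconnected_nhd L Mb ho (show m ∈ (Unsep E p \ {m})ᶜ from fun h => h.2 rfl)
  refine ⟨O, hO, hOo, hmO, fun c hc hcm => ?_⟩
  have hcZ : c ∉ Unsep E p := fun h => hsub hc ⟨h, hcm⟩
  refine ⟨hcZ, ?_⟩
  obtain ⟨m', hm', hf⟩ := hE.frontier_link hcZ
  have hm'O : m' ∈ O := by
    by_contra hn
    obtain ⟨x, hx, hcx⟩ := exists_of_notMem_unsep hcZ
    obtain ⟨y, hy, -, hmy⟩ := hOpc.subset_of_mem hE.dfn_link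
      (disjoint_left.2 fun y hy hyf => hn ((hf ▸ hyf : y ∈ ({m'} : Set Mt)) ▸ hy)) hc
      (⟨x, hx, hcx, hcx⟩ : Link E p c c) hmO
    exact notMem_unsep hy hmy hm
  have : m' = m := by
    by_contra hn
    exact hsub hm'O ⟨hm', hn⟩
  rw [hf, this]

/-- Distinct points are separated by some point. -/
theorem exists_separator [T2Space Mt] (hab : a ≠ b) : ∃ x, a ≠ x ∧ b ∈ Far E a x := by
  by_contra hcon
  have hbZ : b ∈ Unsep E a := by
    by_contra hn
    exact hcon (exists_of_notMem_unsep hn)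
  have haZ : a ∈ Unsep E a := fun c hc _ => hE.refl hc
  obtain ⟨O, hO, hOo, haO, hOf⟩ := hE.exists_nhd_unsep haZ
  -- `B` consists of `O` and all link classes meeting it. It is clopen, hence everything, but it
  -- misses `b`.
  let B : Set Mt := {c | c ∈ O ∨ ∃ o, o ∈ O ∧ Link E a o c}
  have hB : Dfn L Mb B := dfn_iff_dp.2 (DP.or (dfn_iff_dp.1 hO)
    (DP.ex (P := fun c o => o ∈ O ∧ Link E a o c) (DP.and ((dfn_iff_dp.1 hO).comp DMap.id.snd)
      (hE.dp_link (DMap.const a) DMap.id.snd DMap.id.fst))))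
  have hlink : ∀ {c d}, Link E a c d → {y | Link E a c y} = {y | Link E a d y} := by
    intro c d h
    ext y
    exact ⟨fun h' => hE.link_trans h.symm h', fun h' => hE.link_trans h h'⟩
  have hBfr : ∀ c ∈ B, c ≠ a → frontier {y | Link E a c y} = {a} := by
    rintro c (hc | ⟨o, ho, hoc⟩) hca
    · exact (hOf c hc hca).2
    · rw [← hlink hoc]
      exact (hOf o ho (hE.ne_of_link hoc.symm)).2
  have hBo : IsOpen B := by
    have : B = O ∪ ⋃ o ∈ O, {y | Link E a o y} := by
      ext y
      simp [B]
    rw [this]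
    exact hOo.union (isOpen_biUnion fun o _ => hE.isOpen_link)
  have hBc : IsOpen Bᶜ := by
    rw [isOpen_iff_mem_nhds]
    intro y hy
    -- Near an unseparated `y` link classes have frontier `{y}`, whereas those of points of `B`
    -- other than `a` have frontier `{a}`.
    by_cases hyZ : y ∈ Unsep E a
    · obtain ⟨O', -, hO'o, hyO', hO'f⟩ := hE.exists_nhd_unsep hyZ
      refine Filter.mem_of_superset (hO'o.mem_nhds hyO') fun c hc hcB => ?_
      by_cases hcy : c = y
      · exact hy (hcy ▸ hcB)
      · obtain ⟨hcZ, hf⟩ := hO'f c hc hcy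
        have hca : c ≠ a := fun h => hcZ (h ▸ haZ)
        rw [hBfr c hcB hca, singleton_eq_singleton_iff] at hf
        exact hy (hf ▸ Or.inl haO)
    · obtain ⟨x, hx, hyx⟩ := exists_of_notMem_unsep hyZ
      refine Filter.mem_of_superset (hE.isOpen_link.mem_nhds
        (⟨x, hx, hyx, hyx⟩ : Link E a y y)) ?_
      rintro c hc (hcO | ⟨o, ho, hoc⟩)
      · exact hy (Or.inr ⟨c, hcO, Link.symm hc⟩)
      · exact hy (Or.inr ⟨o, ho, hE.link_trans hoc (Link.symm hc)⟩)
  have hfr : frontier B = ∅ :=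
    isClopen_iff_frontier_eq_empty.1 ⟨isOpen_compl_iff.1 hBc, hBo⟩
  have hBu := eq_univ_of_frontier_eq_empty hB hfr ⟨a, Or.inl haO⟩
  rcases (hBu ▸ mem_univ b : b ∈ B) with h | ⟨o, -, x, hx, -, hbx⟩
  · exact (hOf b h hab.symm).1 hbZ
  · exact notMem_unsep hx hbx hbZ

theorem link_self [T2Space Mt] (h : a ≠ p) : Link E p a a :=
  let ⟨x, hx, hax⟩ := hE.exists_separator h.symm
  ⟨x, hx, hax, hax⟩

theorem setOf_ne_and_link : {b | b ≠ p ∧ Link E p a b} = {b | Link E p a b} := by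
  ext b
  exact ⟨fun h => h.2, fun h => ⟨hE.ne_of_link h, h⟩⟩

theorem link [T2Space Mt] : CutRel L Mb (Link E) where
  dp := hE.dp_link DMap.id.fst DMap.id.snd.fst DMap.id.snd.snd
  refl := hE.link_self
  symm := Link.symm
  trans := hE.link_trans
  isOpen _ := by
    rw [hE.setOf_ne_and_link]
    exact hE.isOpen_link
  exists_not x := by
    obtain ⟨a, b, ha, hb, hab⟩ := hE.exists_not x
    refine ⟨a, b, ha, hb, ?_⟩
    rintro ⟨z, hxz, haz, hbz⟩
    exact hab (hE.of_preconnected (hE.preconnected_insert_far hxz)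
      (fun h => h.elim hxz fun h => hE.ne_of_mem_far hxz h rfl) (mem_insert_of_mem _ haz)
      (mem_insert_of_mem _ hbz))

/-- The class is the union of the sets cut off by the separators of `p` from `a`; no separator is
closest to `p`, because another point separates it from `p`. -/
theorem preconnected_near_link [T2Space Mt] : PC L Mb (Near (Link E) a p) := by
  unfold Near
  rw [hE.setOf_ne_and_link, setOf_link]
  refine hE.preconnected_upSet (c := a) (fun x hx => hx) ?_
  rintro x ⟨hx, hax⟩
  obtain ⟨y, hy, hxy⟩ := hE.exists_separator hx
  exact ⟨y, ⟨hy, hE.far_subset hy hxy hax⟩, hxy⟩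

end CutRel

/-- A definable family of equivalence relations as in `CutRel` whose classes are definably
preconnected. -/
structure TreeRel (L : FirstOrder.Language.{w, w'}) {Mt : Type u} (Mb : Type v)
    [L.Structure (Mt ⊕ Mb)] [TopologicalSpace Mt] [Tame L Mt Mb] (E : Mt → Mt → Mt → Prop) :
    Prop extends CutRel L Mb E where
  preconnected_near : ∀ {p x}, PC L Mb (Near E p x)
  exists_link : ∀ {p a b}, a ≠ p → b ≠ p → E p a b → Link E p a b

/-- Linking once more changes nothing: the relation `Link (Link E)` cannot split the connected
classes of `Link E`. -/
theorem CutRel.treeRel [T2Space Mt] {E : Mt → Mt → Mt → Prop} (hE : CutRel L Mb E) :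
    TreeRel L Mb (Link E) where
  toCutRel := hE.link
  preconnected_near := hE.preconnected_near_link
  exists_link ha hb h := hE.link.link.of_preconnected hE.preconnected_near_link
    (fun h => h.1 rfl) (hE.link.mem_near_self ha) ⟨hb, h⟩

end Link

/-! ### Branch points and medians. -/

section Branch

variable {L : FirstOrder.Language.{w, w'}} {Mt : Type u} {Mb : Type v} [L.Structure (Mt ⊕ Mb)]
  [TopologicalSpace Mt] [Tame L Mt Mb]

/-- The points whose complement has at least three classes. -/
def Branch (E : Mt → Mt → Mt → Prop) : Set Mt :=
  {x | ∃ a b c, a ≠ x ∧ b ≠ x ∧ c ≠ x ∧ ¬ E x a b ∧ ¬ E x b c ∧ ¬ E x a c}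

namespace CutRel

variable {E : Mt → Mt → Mt → Prop} (hE : CutRel L Mb E) {p q r x y z a b c : Mt}
include hE

theorem dfn_branch : Dfn L Mb (Branch E) := by
  refine dfn_iff_dp.2 (DP.ex (DP.ex (DP.ex ?_)))
  refine (DP.eq ?_ ?_).not.and ((DP.eq ?_ ?_).not.and ((DP.eq ?_ ?_).not.and
    ((hE.dp_rel ?_ ?_ ?_).not.and ((hE.dp_rel ?_ ?_ ?_).not.and (hE.dp_rel ?_ ?_ ?_).not))))
  all_goals first
    | exact DMap.id.fst.fst.fst
    | exact DMap.id.fst.fst.snd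
    | exact DMap.id.fst.snd
    | exact DMap.id.snd

theorem closure_far_subset (h : p ≠ x) : closure (Far E p x) ⊆ insert x (Far E p x) := by
  rw [closure_eq_self_union_frontier]
  exact union_subset (subset_insert _ _)
    ((hE.frontier_far h).trans (singleton_subset_iff.2 (mem_insert _ _)))

/-- At most one of three points separates the other two. -/
theorem rel_of_not_rel (hqp : q ≠ p) (hrp : r ≠ p) (h : ¬ E p q r) : E r p q :=
  hE.of_preconnected (hE.preconnected_insert_near hqp)
    (fun h' => h'.elim hrp fun h' => h h'.2) (mem_insert _ _)
    (mem_insert_of_mem _ (hE.mem_near_self hqp))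

/-- A third class at `z` would contain points `w` near `z` that still separate `x` from `y`, yet `x`
and `y` are joined through `z` within their own two classes. -/
theorem notMem_branch_of_mem_interior_sep (hz : z ∈ interior {t | Sep E t x y}) :
    z ∉ Branch E := by
  rintro ⟨a, b, c, ha, hb, hc, hab, hbc, hac⟩
  have hzs : z ∈ {t | Sep E t x y} := interior_subset hz
  have hd : ∃ d, d ≠ z ∧ ¬ E z x d ∧ ¬ E z y d := by
    by_contra! hn
    have h1 : ∀ d, d ≠ z → E z x d ∨ E z y d := fun d hd => by
      by_cases h : E z x d
      · exact Or.inl h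
      · exact Or.inr (hn d hd h)
    have h2 : ∀ {s d e}, E z s d → E z s e → E z d e := fun h h' => hE.trans (hE.symm h) h'
    rcases h1 a ha with h | h <;> rcases h1 b hb with h' | h' <;> rcases h1 c hc with h'' | h''
    · exact hab (h2 h h')
    · exact hab (h2 h h')
    · exact hac (h2 h h'')
    · exact hbc (h2 h' h'')
    · exact hbc (h2 h' h'')
    · exact hac (h2 h h'')
    · exact hab (h2 h h')
    · exact hab (h2 h h')
  obtain ⟨d, hd, hxd, hyd⟩ := hd
  obtain ⟨w, hw, hwd⟩ := mem_closure_iff.1 (hE.mem_closure_near hd) _ isOpen_interior hz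
  have hws : w ∈ {t | Sep E t x y} := interior_subset hw
  have hnot : ∀ {s}, ¬ E z s d → w ∉ insert z (Near E s z) := fun h h' =>
    h'.elim hwd.1 fun h' => h (hE.trans h'.2 (hE.symm hwd.2))
  exact hws.2.2 (hE.of_preconnected
    ((hE.preconnected_insert_near hzs.1.symm).union (hE.preconnected_insert_near hzs.2.1.symm)
      (mem_insert _ _) (mem_insert _ _))
    (fun h => h.elim (hnot hxd) (hnot hyd))
    (Or.inl (mem_insert_of_mem _ (hE.mem_near_self hzs.1.symm)))
    (Or.inr (mem_insert_of_mem _ (hE.mem_near_self hzs.2.1.symm))))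

end CutRel

namespace TreeRel

variable {E : Mt → Mt → Mt → Prop} (hE : TreeRel L Mb E) {p q r x y z a b c : Mt}
include hE

/-- A point `t` near `x` in the class of `y` is linked to `y`. The linking point separates `x` from
both; separating two points of a connected neighbourhood, it lies in it. -/
theorem mem_closure_sep (hxy : x ≠ y) : x ∈ closure {z | Sep E z x y} := by
  rw [mem_closure_iff]
  intro O hO hx
  obtain ⟨K, -, hKo, hK, hxK, hKO⟩ := exists_preconnected_nhd L Mb hO hx
  obtain ⟨t, htK, htx, hyt⟩ := mem_closure_iff.1 (hE.mem_closure_near hxy.symm) K hKo hxK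
  obtain ⟨z, hxz, hyz, htz⟩ := hE.exists_link hxy.symm htx hyt
  refine ⟨z, hKO ?_, hxz.symm, hyz.1.symm, hyz.2⟩
  by_contra hzK
  exact htz.2 (hE.of_preconnected hK hzK hxK htK)

theorem finite_branch [T2Space Mt] : (Branch E).Finite := by
  by_contra hinf
  obtain ⟨x, hx⟩ := interior_nonempty_of_infinite hE.dfn_branch hinf
  obtain ⟨K, -, hKo, hK, hxK, hKb⟩ := exists_preconnected_nhd L Mb isOpen_interior hx
  obtain ⟨y, hyK, hyx⟩ := hE.exists_mem_ne hKo hxK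
  have hsub : {z | Sep E z x y} ⊆ K := fun z hz => by
    by_contra hzK
    exact hz.2.2 (hE.of_preconnected hK hzK hxK hyK)
  have hI : {z | Sep E z x y}.Infinite := fun hfin => by
    have := hE.mem_closure_sep hyx.symm
    rw [hfin.isClosed.closure_eq] at this
    exact this.1 rfl
  obtain ⟨z, hz⟩ := interior_nonempty_of_infinite hE.dfn_sep hI
  exact hE.notMem_branch_of_mem_interior_sep hz (interior_subset (hKb (hsub (interior_subset hz))))

/-- If none of three points separates the other two, then some point separates all of them. -/
theorem exists_median [T2Space Mt] (hpq : p ≠ q) (hpr : p ≠ r) (hqr : q ≠ r) (h₁ : E p q r)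
    (h₂ : E q p r) (h₃ : E r p q) :
    ∃ m, p ≠ m ∧ q ≠ m ∧ r ≠ m ∧ ¬ E m p q ∧ ¬ E m q r ∧ ¬ E m p r := by
  by_contra hno
  -- On the way from `p` to `q`, these are the points past the parting from the way to `r`; the
  -- infimum `m` of `T` should be the median.
  let T : Set Mt := {x | p ≠ x ∧ q ∈ Far E p x ∧ ¬ r ∈ Far E p x}
  have hT : Dfn L Mb T := dfn_iff_dp.2 ((DP.eq (DMap.const p) DMap.id).not.and
    ((hE.dp_far (DMap.const p) DMap.id (DMap.const q)).and
      (hE.dp_far (DMap.const p) DMap.id (DMap.const r)).not))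
  have hTc : ∀ x ∈ T, p ≠ x ∧ q ∈ Far E p x := fun x hx => ⟨hx.1, hx.2.1⟩
  have hTr : ∀ x ∈ T, r ≠ x ∧ E x p r := fun x hx => by
    have hrx : r ≠ x := by
      rintro rfl
      exact hx.2.1.2 h₃
    refine ⟨hrx, ?_⟩
    by_contra hn
    exact hx.2.2 ⟨hrx, hn⟩
  have hne : T.Nonempty := by
    obtain ⟨z, hqz, hpz, hrz⟩ := hE.exists_link hpq hqr.symm h₂
    by_cases hz : E z p r
    · exact ⟨z, hpz.1, ⟨hqz, fun h => hpz.2 (hE.symm h)⟩, fun h => h.2 hz⟩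
    · exact (hno ⟨z, hpz.1, hqz, hrz.1, fun h => hpz.2 (hE.symm h), hrz.2, hz⟩).elim
  have hlow : ∀ z, p ≠ z → q ∈ Far E p z → r ∈ Far E p z → UpSet E p T ⊆ Far E p z := by
    rintro z hpz hqz hrz y ⟨x, hx, hyx⟩
    have hxz : x ≠ z := by
      rintro rfl
      exact hx.2.2 hrz
    rcases hE.comparable hx.1 hx.2.1 hqz hxz with h | h
    · exact (hx.2.2 (hE.far_subset hx.1 h hrz)).elim
    · exact hE.far_subset hpz h hyx
  -- A point separating both `p` and `r` from `t` is either in `T` and closer to `p`, or already a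
  -- median.
  have hmin : ∀ x ∈ T, ∃ y ∈ T, x ∈ Far E p y := by
    by_contra! hcon
    obtain ⟨t, ht, htmin⟩ := hcon
    obtain ⟨z, htz, hpz, hrz⟩ := hE.exists_link ht.1 (hTr t ht).1 (hTr t ht).2
    have htz' : t ∈ Far E p z := ⟨htz, fun h => hpz.2 (hE.symm h)⟩
    have hqz : q ∈ Far E p z := hE.far_subset hpz.1 htz' ht.2.1
    by_cases hr : r ∈ Far E p z
    · refine hno ⟨z, hpz.1, hqz.1, hrz.1, hqz.2, fun h => hrz.2 (hE.trans ?_ h), hr.2⟩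
      exact hE.of_preconnected (hE.preconnected_insert_far ht.1)
        (fun h' => h'.elim htz.symm (hE.not_mem_far_of_mem_far hpz.1 htz'))
        (mem_insert _ _) (mem_insert_of_mem _ ht.2.1)
    · exact htmin z ⟨hpz.1, hqz, hr⟩ htz'
  obtain ⟨m, hm⟩ := hE.frontier_upSet hT hTc hne
  have hmf : m ∈ frontier (UpSet E p T) := hm ▸ mem_singleton m
  have hmc : m ∈ closure (UpSet E p T) := hmf.1
  have hmV : m ∉ UpSet E p T := by
    rw [hE.isOpen_upSet.frontier_eq] at hmf
    exact hmf.2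
  have hqV : q ∈ UpSet E p T := let ⟨x, hx⟩ := hne; ⟨x, hx, hx.2.1⟩
  have hpm : p ≠ m := by
    rintro rfl
    obtain ⟨z, hpz, hqz, hrz⟩ := hE.exists_link hpq.symm hpr.symm h₁
    exact (hE.closure_far_subset hpz (closure_mono (hlow z hpz hqz hrz) hmc)).elim hpz
      fun h => hE.ne_of_mem_far hpz h rfl
  have hqm : q ≠ m := fun h => hmV (h ▸ hqV)
  have hqF : q ∈ Far E p m := by
    refine ⟨hqm, fun h => ?_⟩
    obtain ⟨z, hmz, hpz, hqz⟩ := hE.exists_link hpm hqm h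
    have hmF : m ∈ Far E p z := ⟨hmz, fun h => hpz.2 (hE.symm h)⟩
    have hsub := hE.upSet_subset_far hTc hmin hmf hmF
    exact hqz.2 (hE.of_preconnected (hE.preconnected_insert_upSet hTc hmin hmf)
      (fun h' => h'.elim hmz.symm fun h' => (hsub h').1 rfl) (mem_insert _ _)
      (mem_insert_of_mem _ hqV))
  have hrF : r ∈ Far E p m := by
    by_contra hn
    exact hmV (hmin m ⟨hpm, hqF, hn⟩)
  have hEm : E m q r := by
    by_contra hn
    exact hno ⟨m, hpm, hqm, hrF.1, hqF.2, hn, hrF.2⟩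
  -- Such a `z` lies beyond `m` and cuts off both `q` and `r` from `p`, so by `hlow` it bounds `T`
  -- from below, contradicting that `m` is its infimum.
  obtain ⟨z, hmz, hqz, hrz⟩ := hE.exists_link hqm hrF.1 hEm
  have hzF : z ∈ Far E p m := by
    by_contra hn
    exact hqz.2 (hE.of_preconnected (hE.preconnected_insert_far hpm)
      (fun h' => h'.elim hmz.symm hn) (mem_insert _ _) (mem_insert_of_mem _ hqF))
  have hpz : p ≠ z := (hE.ne_of_mem_far hpm hzF).symm
  have hmz' : m ∉ Far E p z := hE.not_mem_far_of_mem_far hpm hzF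
  have hEz : E z p m := by
    by_contra hn
    exact hmz' ⟨hmz, hn⟩
  have hsub := hlow z hpz ⟨hqz.1, fun h => hqz.2 (hE.trans (hE.symm hEz) h)⟩
    ⟨hrz.1, fun h => hrz.2 (hE.trans (hE.symm hEz) h)⟩
  exact (hE.closure_far_subset hpz (closure_mono hsub hmc)).elim hmz hmz'

/-- If `s` does not separate `a` from `b`, some `z` separates both from `s`. Points `x` near `s` lie
on its side of `z`, so `z` is joined to `a` and to `b` avoiding `x`. -/
theorem closure_sep_subset : closure {z | Sep E z a b} ⊆ insert a (insert b {z | Sep E z a b}) := by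
  intro s hs
  by_contra hn
  simp only [mem_insert_iff, not_or] at hn
  obtain ⟨hsa, hsb, hsep⟩ := hn
  have hEs : E s a b := by
    by_contra h
    exact hsep ⟨hsa, hsb, h⟩
  obtain ⟨z, hsz, haz, hbz⟩ := hE.exists_link (Ne.symm hsa) (Ne.symm hsb) hEs
  obtain ⟨K, -, hKo, hK, hsK, hKz⟩ := exists_preconnected_nhd L Mb
    (hE.isOpen_near hsz) (hE.mem_near_self hsz)
  obtain ⟨x, hxK, hx⟩ := mem_closure_iff.1 hs K hKo hsK
  have hxs : E z s x := (hKz hxK).2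
  have hxz : x ≠ z := (hKz hxK).1
  have key : ∀ {d}, x ≠ d → d ∈ Far E s z → z ∈ Near E d x := by
    intro d hxd hd
    by_contra hz
    exact hd.2 (hE.trans hxs (hE.of_preconnected (hE.preconnected_insert_near hxd.symm)
      (fun h' => h'.elim hxz.symm hz) (mem_insert _ _)
      (mem_insert_of_mem _ (hE.mem_near_self hxd.symm))))
  exact hx.2.2 (hE.trans (key hx.1 haz).2 (hE.symm (key hx.2.1 hbz).2))

/-! ### Betweenness on a connected open set without branch points. -/

section Edge

variable {C : Set Mt} (hCo : IsOpen C) (hC : PC L Mb C) (hCB : Disjoint C (Branch E))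

include hC in
theorem mem_of_sep (ha : a ∈ C) (hb : b ∈ C) (h : Sep E z a b) : z ∈ C := by
  by_contra hz
  exact h.2.2 (hE.of_preconnected hC hz ha hb)

include hCB in
omit hE [L.Structure (Mt ⊕ Mb)] [TopologicalSpace Mt] [Tame L Mt Mb] in
theorem rel_or_rel (hx : x ∈ C) (ha : a ≠ x) (hb : b ≠ x) (hc : c ≠ x) (hab : ¬ E x a b) :
    E x b c ∨ E x a c := by
  by_contra! h
  exact disjoint_left.1 hCB hx ⟨a, b, c, ha, hb, hc, hab, h.1, h.2⟩

include hC hCB in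
theorem exists_separating [T2Space Mt] (hp : p ∈ C) (hq : q ∈ C) (hpq : p ≠ q)
    (hpr : p ≠ r) (hqr : q ≠ r) : ¬ E p q r ∨ ¬ E q p r ∨ ¬ E r p q := by
  by_contra! h
  obtain ⟨m, hpm, hqm, hrm, h1, h2, h3⟩ := hE.exists_median hpq hpr hqr h.1 h.2.1 h.2.2
  exact disjoint_left.1 hCB (hE.mem_of_sep hC hp hq ⟨hpm.symm, hqm.symm, h1⟩)
    ⟨p, q, r, hpm, hqm, hrm, h1, h2, h3⟩

include hCo hC hCB in
theorem isOpen_sep [T2Space Mt] (ha : a ∈ C) (hb : b ∈ C) (hab : a ≠ b) :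
    IsOpen {z | Sep E z a b} := by
  have : {z | Sep E z a b} = C ∩ (Near E b a ∩ Near E a b) := by
    ext z
    constructor
    · intro hz
      exact ⟨hE.mem_of_sep hC ha hb hz,
        ⟨hz.1, hE.symm (hE.rel_of_not_rel hz.2.1.symm hz.1.symm fun h => hz.2.2 (hE.symm h))⟩,
        hz.2.1, hE.symm (hE.rel_of_not_rel hz.1.symm hz.2.1.symm hz.2.2)⟩
    · rintro ⟨-, hza, hzb⟩
      refine ⟨hza.1, hzb.1, ?_⟩
      rcases hE.exists_separating hC hCB ha hb hab hza.1.symm hzb.1.symm with h | h | h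
      · exact (h hza.2).elim
      · exact (h hzb.2).elim
      · exact h
  rw [this]
  exact hCo.inter ((hE.isOpen_near hab.symm).inter (hE.isOpen_near hab))

-- A proper component `K` of the separating set has frontier in `{a, b}` and must accumulate at both
-- ends. Then `K` with `a` and `b` is connected and avoids some point that separates `a` from `b`.
include hCo hC hCB in
theorem preconnected_sep [T2Space Mt] (ha : a ∈ C) (hb : b ∈ C) (hab : a ≠ b) :
    PC L Mb {z | Sep E z a b} := by
  intro S hS hdj
  by_contra! hcon
  obtain ⟨h1, h2⟩ := hcon
  obtain ⟨t, ht, htS⟩ := not_subset.1 h1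
  obtain ⟨u, hu, huS⟩ := not_disjoint_iff.1 h2
  obtain ⟨K, hKd, hKo, hK, huK, hKI, hKf⟩ :=
    exists_preconnected_component hE.dfn_sep (hE.isOpen_sep hCo hC hCB ha hb hab) hu
  have htK : t ∉ K := fun h => htS (hK.subset_of_mem hS (hdj.mono_left hKI) huK huS h)
  have hfr : ∀ y ∈ frontier K, y = a ∨ y = b := fun y hy => by
    rcases hE.closure_sep_subset (closure_mono hKI hy.1) with h | h | h
    · exact Or.inl h
    · exact Or.inr h
    · exact (disjoint_left.1 hKf h hy).elim
  have key : ∀ {d e}, d ≠ e → u ≠ e → E e u d → d ∉ K → (∀ y ∈ frontier K, y = d ∨ y = e) →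
      d ∈ closure K := by
    intro d e hde hue hEd hdK hf
    by_contra hd
    have hNK := (hE.preconnected_near (p := u) (x := e)).subset_of_mem hKd
      (disjoint_left.2 fun y hy hyf => ?_) (hE.mem_near_self hue) huK
    · exact hdK (hNK ⟨hde, hEd⟩)
    · rcases hf y hyf with rfl | rfl
      · exact hd hyf.1
      · exact hy.1 rfl
  have haK : a ∈ closure K := key hab hu.2.1
    (hE.rel_of_not_rel hu.1.symm hu.2.1.symm hu.2.2)
    (fun h => (hKI h).1 rfl) hfr
  have hbK : b ∈ closure K := key hab.symm hu.1
    (hE.rel_of_not_rel hu.2.1.symm hu.1.symm fun h => hu.2.2 (hE.symm h))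
    (fun h => (hKI h).2.1 rfl) fun y hy => (hfr y hy).symm
  have hpc : PC L Mb (insert a (insert b K)) := hK.subset_closure
    ((subset_insert _ _).trans (subset_insert _ _))
    (insert_subset haK (insert_subset hbK subset_closure))
  exact ht.2.2 (hE.of_preconnected hpc
    (fun h => h.elim ht.1 fun h => h.elim ht.2.1 htK) (mem_insert _ _)
    (mem_insert_of_mem _ (mem_insert _ _)))

include hCo hC hCB in
theorem preconnected_segment [T2Space Mt] (ha : a ∈ C) (hb : b ∈ C) (hab : a ≠ b) :
    PC L Mb (insert a (insert b {z | Sep E z a b})) := by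
  refine (hE.preconnected_sep hCo hC hCB ha hb hab).subset_closure
    ((subset_insert _ _).trans (subset_insert _ _))
    (insert_subset (hE.mem_closure_sep hab) (insert_subset ?_ subset_closure))
  have : {z | Sep E z a b} = {z | Sep E z b a} := by
    ext z
    exact ⟨fun h => ⟨h.2.1, h.1, fun h' => h.2.2 (hE.symm h')⟩,
      fun h => ⟨h.2.1, h.1, fun h' => h.2.2 (hE.symm h')⟩⟩
  rw [this]
  exact hE.mem_closure_sep hab.symm

end Edge

end TreeRel

end Branch

/-- If a subset of a linear order can only change its status at points of a finite set, it is a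
finite union of points and open intervals. -/
theorem exists_finite_pointOrInterval {D : Type u} [LinearOrder D] {B S : Set D} (hB : B.Finite)
    (h : ∀ s t, s ∈ S → (∀ z ∈ B, ¬ (min s t ≤ z ∧ z ≤ max s t)) → t ∈ S) :
    ∃ F : Set (Set D), F.Finite ∧ (∀ I ∈ F, IsPointOrInterval I) ∧ S = ⋃₀ F := by
  let G : Set (Set D) := singleton '' B ∪ (image2 Ioo B B ∪ (Iio '' B ∪ (Ioi '' B ∪ {univ})))
  have hG : G.Finite := (hB.image _).union ((hB.image2 _ hB).union
    ((hB.image _).union ((hB.image _).union (finite_singleton _))))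
  refine ⟨{I ∈ G | I ⊆ S}, hG.subset (sep_subset _ _), ?_, ?_⟩
  · rintro I ⟨⟨a, -, rfl⟩ | ⟨a, -, b, -, rfl⟩ | ⟨a, -, rfl⟩ | ⟨a, -, rfl⟩ | rfl, -⟩
    · exact Or.inl ⟨a, rfl⟩
    · exact Or.inr (Or.inl ⟨a, b, rfl⟩)
    · exact Or.inr (Or.inr (Or.inl ⟨a, rfl⟩))
    · exact Or.inr (Or.inr (Or.inr (Or.inl ⟨a, rfl⟩)))
    · exact Or.inr (Or.inr (Or.inr (Or.inr rfl)))
  refine subset_antisymm (fun s hs => ?_) (sUnion_subset fun I hI => hI.2)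
  by_cases hsB : s ∈ B
  · exact ⟨{s}, ⟨Or.inl ⟨s, hsB, rfl⟩, singleton_subset_iff.2 hs⟩, rfl⟩
  have hl : (∀ b ∈ B, ¬ b < s) ∨ ∃ l ∈ B, l < s ∧ ∀ b ∈ B, b < s → b ≤ l := by
    rcases (B ∩ Iio s).eq_empty_or_nonempty with h0 | h0
    · exact Or.inl fun b hb hbs => eq_empty_iff_forall_notMem.1 h0 b ⟨hb, hbs⟩
    · obtain ⟨l, hl, hm⟩ := exists_max_image _ id (hB.subset inter_subset_left) h0
      exact Or.inr ⟨l, hl.1, hl.2, fun b hb hbs => hm b ⟨hb, hbs⟩⟩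
  have hu : (∀ b ∈ B, ¬ s < b) ∨ ∃ l ∈ B, s < l ∧ ∀ b ∈ B, s < b → l ≤ b := by
    rcases (B ∩ Ioi s).eq_empty_or_nonempty with h0 | h0
    · exact Or.inl fun b hb hbs => eq_empty_iff_forall_notMem.1 h0 b ⟨hb, hbs⟩
    · obtain ⟨l, hl, hm⟩ := exists_min_image _ id (hB.subset inter_subset_left) h0
      exact Or.inr ⟨l, hl.1, hl.2, fun b hb hbs => hm b ⟨hb, hbs⟩⟩
  have hne : ∀ z ∈ B, z < s ∨ s < z := fun z hz => lt_or_gt_of_ne fun h => hsB (h ▸ hz)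
  rcases hl with hl | ⟨l, hlB, hls, hl⟩ <;> rcases hu with hu | ⟨u, huB, hsu, hu⟩
  · refine ⟨univ, ⟨Or.inr (Or.inr (Or.inr (Or.inr rfl))), fun t _ => h s t hs ?_⟩, mem_univ s⟩
    rintro z hz -
    rcases hne z hz with h1 | h1
    · exact hl z hz h1
    · exact hu z hz h1
  · refine ⟨Iio u, ⟨Or.inr (Or.inr (Or.inl ⟨u, huB, rfl⟩)), fun t ht => h s t hs ?_⟩, hsu⟩
    rintro z hz ⟨-, h3⟩
    rcases hne z hz with h1 | h1
    · exact hl z hz h1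
    · exact absurd (hu z hz h1) (not_le.2 (h3.trans_lt (max_lt hsu ht)))
  · refine ⟨Ioi l, ⟨Or.inr (Or.inr (Or.inr (Or.inl ⟨l, hlB, rfl⟩))), fun t ht => h s t hs ?_⟩,
      hls⟩
    rintro z hz ⟨h3, -⟩
    rcases hne z hz with h1 | h1
    · exact absurd (hl z hz h1) (not_le.2 ((lt_min hls ht).trans_le h3))
    · exact hu z hz h1
  · refine ⟨Ioo l u, ⟨Or.inr (Or.inl ⟨l, hlB, u, huB, rfl⟩), fun t ht => h s t hs ?_⟩, hls, hsu⟩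
    rintro z hz ⟨h3, h4⟩
    rcases hne z hz with h1 | h1
    · exact absurd (hl z hz h1) (not_le.2 ((lt_min hls ht.1).trans_le h3))
    · exact absurd (hu z hz h1) (not_le.2 (h4.trans_lt (max_lt hsu ht.2)))

/-! ### The linear order on a component and o-minimality. -/

section Order

variable {L : FirstOrder.Language.{w, w'}} {Mt : Type u} {Mb : Type v} [L.Structure (Mt ⊕ Mb)]
  [TopologicalSpace Mt] [Tame L Mt Mb]

/-- The points to the right of `x`, for the orientation in which `x₁` is to the right of `x₀`. -/
def Right (E : Mt → Mt → Mt → Prop) (x₀ x₁ x : Mt) : Set Mt :=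
  {z | z ≠ x ∧ (x = x₀ ∧ E x₀ x₁ z ∨ x ≠ x₀ ∧ (E x₀ x₁ x ↔ ¬ E x x₀ z))}

theorem CutRel.dp_right {E : Mt → Mt → Mt → Prop} (hE : CutRel L Mb E) {x₀ x₁ : Mt} :
    DP L (univ : Set (Mt ⊕ Mb)) (fun p : Mt × Mt => p.2 ∈ Right E x₀ x₁ p.1) := by
  have h0 : DP L (univ : Set (Mt ⊕ Mb)) (fun p : Mt × Mt => p.1 = x₀) :=
    DP.eq DMap.id.fst (DMap.const x₀)
  exact (DP.eq DMap.id.snd DMap.id.fst).not.and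
    ((h0.and (hE.dp_rel (DMap.const x₀) (DMap.const x₁) DMap.id.snd)).or
      (h0.not.and ((hE.dp_rel (DMap.const x₀) (DMap.const x₁) DMap.id.fst).iff
        (hE.dp_rel DMap.id.fst (DMap.const x₀) DMap.id.snd).not)))

namespace TreeRel

variable {E : Mt → Mt → Mt → Prop} (hE : TreeRel L Mb E) {x₀ x₁ x y z a b c : Mt}
  {C : Set Mt} (hCo : IsOpen C) (hC : PC L Mb C) (hCB : Disjoint C (Branch E)) (hx₀ : x₀ ∈ C)
  (hx₁ : x₁ ≠ x₀)

include hE hCB in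
theorem rel_iff_rel_iff_rel (hx : x ∈ C) (hc : c ≠ x) (ha : a ≠ x) (hb : b ≠ x) :
    E x a b ↔ (E x c a ↔ E x c b) := by
  constructor
  · exact fun h => ⟨fun h' => hE.trans h' h, fun h' => hE.trans h' (hE.symm h)⟩
  · intro h
    by_cases hca : E x c a
    · exact hE.trans (hE.symm hca) (h.1 hca)
    · exact (rel_or_rel hCB hx hc ha hb hca).resolve_right fun h' => hca (h.2 h')

-- Without branching there are just two classes at `x`, and `Right` selects one of them.
include hE hCB hx₁ in
theorem rel_iff_mem_right (hx : x ∈ C) (ha : a ≠ x) (hb : b ≠ x) :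
    E x a b ↔ (a ∈ Right E x₀ x₁ x ↔ b ∈ Right E x₀ x₁ x) := by
  by_cases hxx : x = x₀
  · subst hxx
    rw [hE.rel_iff_rel_iff_rel hCB hx hx₁ ha hb]
    simp [Right, ha, hb]
  · rw [hE.rel_iff_rel_iff_rel hCB hx (Ne.symm hxx) ha hb]
    simp only [Right, mem_ofPred_eq, ha, hb, hxx, ne_eq, not_false_eq_true, true_and, false_and,
      false_or]
    tauto

-- Gives totality and asymmetry. Away from `x₀` it is a propositional consequence of how `x₀`, `x`
-- and `y` separate one another.
include hE hC hCB hx₀ hx₁ in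
theorem mem_right_iff_notMem_right [T2Space Mt] (hx : x ∈ C) (hxy : x ≠ y) :
    y ∈ Right E x₀ x₁ x ↔ x ∉ Right E x₀ x₁ y := by
  by_cases hxx : x = x₀
  · subst hxx
    simp [Right, hxy, hxy.symm, hE.refl hxy]
  by_cases hyx : y = x₀
  · subst hyx
    simp [Right, hxy, hxy.symm, hE.refl hxy.symm]
  have h0 := hE.rel_iff_rel_iff_rel hCB hx₀ hx₁ hxx hyx
  have h1 := hE.exists_separating hC hCB hx₀ hx (Ne.symm hxx) (Ne.symm hyx) hxy
  have h2 : ¬ E x₀ x y → E y x₀ x := fun h => hE.rel_of_not_rel hxx hyx h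
  have h3 : ¬ E x₀ x y → E x x₀ y := fun h =>
    hE.rel_of_not_rel hyx hxx fun h' => h (hE.symm h')
  have h4 : ¬ E x x₀ y → E y x x₀ := fun h => hE.rel_of_not_rel (Ne.symm hxx) hxy.symm h
  have h5 : E y x x₀ → E y x₀ x := hE.symm
  simp only [Right, mem_ofPred_eq, hxy, hxy.symm, hxx, hyx, ne_eq, not_false_eq_true, true_and,
    false_and, false_or]
  tauto

include hE hC hCB hx₀ hx₁ in
theorem right_trans [T2Space Mt] (hx : x ∈ C) (hy : y ∈ C)
    (hxy : y ∈ Right E x₀ x₁ x) (hyz : z ∈ Right E x₀ x₁ y) : z ∈ Right E x₀ x₁ x := by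
  have hyx : x ∉ Right E x₀ x₁ y :=
    (hE.mem_right_iff_notMem_right hC hCB hx₀ hx₁ hx hxy.1.symm).1 hxy
  have hzx : z ≠ x := by
    rintro rfl
    exact hyx hyz
  have h1 : ¬ E y z x := fun h =>
    hyx (((hE.rel_iff_mem_right hCB hx₁ hy hyz.1 hxy.1.symm).1 h).1 hyz)
  have h2 : E x y z := hE.rel_of_not_rel hyz.1 hxy.1.symm h1
  exact ((hE.rel_iff_mem_right hCB hx₁ hx hxy.1 hzx).1 h2).1 hxy

section LinearOrder

variable [LinearOrder C] (hlt : ∀ x y : C, x < y ↔ (y : Mt) ∈ Right E x₀ x₁ x)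

include hE hCB hx₁ hlt in
theorem sep_iff_of_order {a b z : C} : Sep E (z : Mt) a b ↔ z ≠ a ∧ z ≠ b ∧ ¬ (z < a ↔ z < b) := by
  have hne : ∀ {x y : C}, (x : Mt) ≠ y ↔ x ≠ y := Subtype.coe_injective.ne_iff
  constructor
  · rintro ⟨h1, h2, h3⟩
    rw [hE.rel_iff_mem_right hCB hx₁ z.2 h1.symm h2.symm, ← hlt, ← hlt] at h3
    exact ⟨hne.1 h1, hne.1 h2, h3⟩
  · rintro ⟨h1, h2, h3⟩
    refine ⟨hne.2 h1, hne.2 h2, ?_⟩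
    rwa [hE.rel_iff_mem_right hCB hx₁ z.2 (hne.2 h1).symm (hne.2 h2).symm, ← hlt, ← hlt]

-- A connected neighbourhood of `x` meets both classes at `x`, hence both sides, and contains every
-- point separating two of its points.
include hE hCB hx₁ hlt in
theorem exists_lt_and_sep_subset {O : Set Mt} (hO : IsOpen O) (hOC : O ⊆ C) {x : C}
    (hx : (x : Mt) ∈ O) :
    (∃ y : C, x < y ∧ (y : Mt) ∈ O ∧ ∀ z : C, x < z → z < y → (z : Mt) ∈ O) ∧
    (∃ y : C, y < x ∧ (y : Mt) ∈ O ∧ ∀ z : C, y < z → z < x → (z : Mt) ∈ O) := by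
  obtain ⟨K, -, hKo, hK, hxK, hKO⟩ := exists_preconnected_nhd L Mb hO hx
  have hsep : ∀ y : C, (y : Mt) ∈ K → ∀ z : C, Sep E (z : Mt) x y → (z : Mt) ∈ K := by
    intro y hy z hz
    by_contra hzK
    exact hz.2.2 (hE.of_preconnected hK hzK hxK hy)
  have hclass : ∀ a : Mt, a ≠ x → ∃ y : C, (y : Mt) ∈ K ∧ y ≠ x ∧ E x a y := by
    intro a ha
    obtain ⟨y, hyK, hyx, hay⟩ := mem_closure_iff.1 (hE.mem_closure_near ha) K hKo hxK
    exact ⟨⟨y, hOC (hKO hyK)⟩, hyK, fun h => hyx (congrArg Subtype.val h), hay⟩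
  have hsplit : ∃ a b : C, ((a : Mt) ∈ K ∧ a ≠ x) ∧ ((b : Mt) ∈ K ∧ b ≠ x) ∧
      ¬ (x < a ↔ x < b) := by
    obtain ⟨a, b, ha, hb, hab⟩ := hE.exists_not x
    obtain ⟨a', ha'K, ha'x, ha'⟩ := hclass a ha
    obtain ⟨b', hb'K, hb'x, hb'⟩ := hclass b hb
    refine ⟨a', b', ⟨ha'K, ha'x⟩, ⟨hb'K, hb'x⟩, fun h => hab ?_⟩
    rw [hlt, hlt, ← hE.rel_iff_mem_right hCB hx₁ x.2 (Subtype.coe_injective.ne ha'x)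
      (Subtype.coe_injective.ne hb'x)] at h
    exact hE.trans ha' (hE.trans h (hE.symm hb'))
  have hup : ∃ y : C, x < y ∧ (y : Mt) ∈ K := by
    obtain ⟨a, b, ha, hb, hab⟩ := hsplit
    by_cases h : x < a
    · exact ⟨a, h, ha.1⟩
    · exact ⟨b, by tauto, hb.1⟩
  have hdown : ∃ y : C, y < x ∧ (y : Mt) ∈ K := by
    obtain ⟨a, b, ha, hb, hab⟩ := hsplit
    by_cases h : x < a
    · exact ⟨b, lt_of_le_of_ne (not_lt.1 fun h' => hab (iff_of_true h h')) hb.2, hb.1⟩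
    · exact ⟨a, lt_of_le_of_ne (not_lt.1 h) ha.2, ha.1⟩
  obtain ⟨y, hxy, hyK⟩ := hup
  obtain ⟨y', hxy', hyK'⟩ := hdown
  refine ⟨⟨y, hxy, hKO hyK, fun z h1 h2 => hKO (hsep y hyK z ?_)⟩,
    ⟨y', hxy', hKO hyK', fun z h1 h2 => hKO (hsep y' hyK' z ?_)⟩⟩
  · rw [hE.sep_iff_of_order hCB hx₁ hlt]
    exact ⟨h1.ne', h2.ne, fun h => (h.2 h2).not_gt h1⟩
  · rw [hE.sep_iff_of_order hCB hx₁ hlt]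
    exact ⟨h2.ne, h1.ne', fun h => (h.1 h2).not_gt h1⟩

-- Open rays at `a` are traces on `C` of classes at `a`, which are open; conversely
-- `exists_lt_and_sep_subset` puts an interval inside every neighbourhood.
include hE hCo hCB hx₁ hlt in
theorem orderTopology : OrderTopology C := by
  have hclass : ∀ a : C, ∀ S : Set C, a ∉ S →
      (∀ y ∈ S, ∀ z : C, z ≠ a → (a < y ↔ a < z) → z ∈ S) → IsOpen S := by
    intro a S haS hS
    rw [isOpen_iff_mem_nhds]
    intro y hy
    have hya : y ≠ a := fun h => haS (h ▸ hy)
    have ho : IsOpen ((Subtype.val : C → Mt) ⁻¹' Near E y a) :=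
      (hE.isOpen_near (Subtype.coe_injective.ne hya)).preimage continuous_subtype_val
    refine Filter.mem_of_superset
      (ho.mem_nhds (hE.mem_near_self (Subtype.coe_injective.ne hya))) ?_
    rintro z ⟨hza, hz⟩
    refine hS y hy z (fun h => hza (congrArg _ h)) ?_
    rwa [hE.rel_iff_mem_right hCB hx₁ a.2 (Subtype.coe_injective.ne hya) hza, ← hlt, ← hlt] at hz
  refine ⟨le_antisymm (le_generateFrom ?_) ?_⟩
  · rintro s ⟨a, rfl | rfl⟩
    · exact hclass a _ (lt_irrefl a) fun y hy z _ h => h.1 hy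
    · refine hclass a _ (lt_irrefl a) fun y hy z hz h => ?_
      exact lt_of_le_of_ne (not_lt.1 fun h' => (h.2 h').not_gt hy) hz
  · intro U hU
    let _ := TopologicalSpace.generateFrom {s : Set C | ∃ a, s = Ioi a ∨ s = Iio a}
    rw [isOpen_iff_forall_mem_open]
    intro x hx
    obtain ⟨O, hO, rfl⟩ := isOpen_induced_iff.1 hU
    obtain ⟨⟨b, hxb, hbO, hb⟩, ⟨a, hax, haO, ha⟩⟩ :=
      hE.exists_lt_and_sep_subset hCB hx₁ hlt (hO.inter hCo) inter_subset_right
        (x := x) ⟨hx, x.2⟩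
    refine ⟨Ioi a ∩ Iio b, ?_, ?_, ⟨hax, hxb⟩⟩
    · rintro z ⟨haz, hzb⟩
      rcases lt_trichotomy z x with h | h | h
      · exact (ha z haz h).1
      · exact h ▸ hx
      · exact (hb z h hzb).1
    · exact IsOpen.inter (TopologicalSpace.GenerateOpen.basic (Ioi a) ⟨a, Or.inl rfl⟩)
        (TopologicalSpace.GenerateOpen.basic (Iio b) ⟨b, Or.inr rfl⟩)

-- Membership in `S` changes only at its finitely many frontier points, since closed segments are
-- connected.
include hE hCo hC hCB hx₁ hlt in
theorem exists_finite_pointOrInterval_of_dfn [T2Space Mt] {S : Set Mt} (hS : Dfn L Mb S) :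
    ∃ F : Set (Set C), F.Finite ∧ (∀ I ∈ F, IsPointOrInterval I) ∧
      (Subtype.val : C → Mt) ⁻¹' S = ⋃₀ F := by
  refine exists_finite_pointOrInterval
    ((Tame.finite_frontier S hS).preimage Subtype.val_injective.injOn) ?_
  intro s t hs hst
  by_cases hne : s = t
  · exact hne ▸ hs
  refine (hE.preconnected_segment hCo hC hCB s.2 t.2
    (Subtype.coe_injective.ne hne)).subset_of_mem hS ?_ (mem_insert _ _) hs
    (mem_insert_of_mem _ (mem_insert _ _))
  rw [disjoint_left]
  rintro z (rfl | rfl | hz) hzf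
  · exact hst s hzf ⟨min_le_left _ _, le_max_left _ _⟩
  · exact hst t hzf ⟨min_le_right _ _, le_max_right _ _⟩
  · lift z to C using hE.mem_of_sep hC s.2 t.2 hz
    rw [mem_ofPred_eq, hE.sep_iff_of_order hCB hx₁ hlt] at hz
    obtain ⟨h1, h2, h3⟩ := hz
    refine hst z hzf ?_
    rcases lt_or_gt_of_ne h1 with h1 | h1 <;> rcases lt_or_gt_of_ne h2 with h2 | h2
    · exact (h3 (iff_of_true h1 h2)).elim
    · exact ⟨(min_le_right _ _).trans h2.le, h1.le.trans (le_max_left _ _)⟩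
    · exact ⟨(min_le_left _ _).trans h1.le, h2.le.trans (le_max_right _ _)⟩
    · exact (h3 (iff_of_false h1.not_gt h2.not_gt)).elim

end LinearOrder

include hE hCo hC hCB in
theorem isOMinimal [T2Space Mt] (hCd : Dfn L Mb C) (hne : C.Nonempty) : IsOMinimal L Mb C := by
  classical
  obtain ⟨x₀, hx₀⟩ := hne
  obtain ⟨x₁, -, hx₁⟩ := hE.exists_mem_ne hCo hx₀
  let r : C → C → Prop := fun x y => (y : Mt) ∈ Right E x₀ x₁ x
  have hr : ∀ x y : C, x ≠ y → (r x y ↔ ¬ r y x) := fun x y hxy =>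
    hE.mem_right_iff_notMem_right hC hCB hx₀ hx₁ x.2 (Subtype.coe_injective.ne hxy)
  have : IsStrictTotalOrder C r :=
    { irrefl := fun x h => h.1 rfl
      trans := fun x y z => hE.right_trans hC hCB hx₀ hx₁ x.2 y.2
      trichotomous := fun x y h1 h2 => by
        by_contra hxy
        exact h1 ((hr x y hxy).2 h2) }
  let _ : LinearOrder C := linearOrderOfSTO r
  have hlt : ∀ x y : C, x < y ↔ (y : Mt) ∈ Right E x₀ x₁ x := fun _ _ => Iff.rfl
  have hnbd := fun x : C =>
    hE.exists_lt_and_sep_subset hCB hx₁ hlt hCo Subset.rfl (x := x) x.2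
  refine ⟨inferInstance, ?_, ⟨fun a b hab => ?_⟩, ⟨fun a => ?_⟩, ⟨fun a => ?_⟩,
    hE.orderTopology hCo hCB hx₁ hlt,
    fun S _ hS => hE.exists_finite_pointOrInterval_of_dfn hCo hC hCB hx₁ hlt hS⟩
  · have h1 : DP L (univ : Set (Mt ⊕ Mb))
        (fun p : Mt × Mt => p.1 ∈ C ∧ p.2 ∈ C ∧ p.2 ∈ Right E x₀ x₁ p.1) :=
      ((dfn_iff_dp.1 hCd).comp DMap.id.fst).and
        (((dfn_iff_dp.1 hCd).comp DMap.id.snd).and hE.dp_right)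
    refine definable_of_eq (Definable.preimage_comp
      (fun i => (Sum.elim (fun _ => 0) (fun _ => 1) i : Fin 2)) h1) ?_
    ext v
    constructor
    · rintro ⟨x, y, hxy, hv⟩
      rw [Prod.mk.injEq] at hv
      refine ⟨((x : Mt), (y : Mt)), ⟨x.2, y.2, hxy⟩, funext fun i => ?_⟩
      rcases i with i | i
      · exact hv.1.symm
      · exact hv.2.symm
    · rintro ⟨⟨x, y⟩, ⟨hx, hy, hxy⟩, hv⟩
      exact ⟨⟨x, hx⟩, ⟨y, hy⟩, hxy, Prod.ext (congrFun hv (Sum.inl (0 : Fin 1))).symm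
        (congrFun hv (Sum.inr (0 : Fin 1))).symm⟩
  · obtain ⟨z, haz, hbz⟩ := hE.exists_separator (Subtype.coe_injective.ne hab.ne)
    have hz : Sep E z a b := ⟨haz.symm, hbz.1.symm, hbz.2⟩
    lift z to C using hE.mem_of_sep hC a.2 b.2 hz
    rw [hE.sep_iff_of_order hCB hx₁ hlt] at hz
    obtain ⟨h1, h2, h3⟩ := hz
    rcases lt_or_gt_of_ne h1 with h1 | h1
    · exact (h3 (iff_of_true h1 (h1.trans hab))).elim
    · refine ⟨z, h1, lt_of_le_of_ne (not_lt.1 fun h => ?_) h2⟩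
      exact h3 (iff_of_false h1.not_gt h.not_gt)
  · obtain ⟨y, hy, -⟩ := (hnbd a).2
    exact ⟨y, hy⟩
  · obtain ⟨y, hy, -⟩ := (hnbd a).1
    exact ⟨y, hy⟩

end TreeRel

theorem isDefComponent_iff {C Y : Set Mt} (hY : IsOpen Y) :
    IsDefComponent L Mb C Y ↔ C ⊆ Y ∧ Dfn L Mb C ∧ IsOpen C ∧ Disjoint Y (frontier C) ∧
      C.Nonempty ∧ PC L Mb C := by
  unfold IsDefComponent
  rw [isClopen_preimage_val_iff hY]
  constructor
  · rintro ⟨h1, h2, h3, h4⟩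
    have ho : IsOpen C := by
      rw [← interior_eq_iff_isOpen]
      refine subset_antisymm interior_subset fun y hy => ?_
      by_contra hyi
      exact disjoint_left.1 h3 (h1 hy) ⟨subset_closure hy, hyi⟩
    exact ⟨h1, h2, ho, h3, (defConnected_iff h2 ho).1 h4⟩
  · rintro ⟨h1, h2, ho, h3, h4⟩
    exact ⟨h1, h2, h3, (defConnected_iff h2 ho).2 h4⟩

theorem finite_and_sUnion_components {Y : Set Mt} (hY : Dfn L Mb Y) (hYo : IsOpen Y) :
    {C : Set Mt | IsDefComponent L Mb C Y}.Finite ∧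
      ⋃₀ {C : Set Mt | IsDefComponent L Mb C Y} = Y := by
  obtain ⟨d, f, hf, -, hU⟩ := exists_partition_preconnected hY hYo (Tame.numComponents_lt_top Y hY)
  have hsub : ∀ i, f i ⊆ Y := fun i => hU ▸ subset_iUnion f i
  constructor
  · refine (finite_range f).subset fun C hC => ?_
    obtain ⟨hCY, hCd, -, hCf, ⟨y, hy⟩, hCpc⟩ := (isDefComponent_iff hYo).1 hC
    obtain ⟨i, hi⟩ := mem_iUnion.1 (hU.symm ▸ hCY hy : y ∈ ⋃ i, f i)
    exact ⟨i, subset_antisymm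
      ((hf i).2.2.2.2.subset_of_mem hCd (hCf.mono_left (hsub i)) hi hy)
      (hCpc.subset_of_mem (hf i).2.1 ((hf i).2.2.2.1.mono_left hCY) hy hi)⟩
  · refine subset_antisymm (sUnion_subset fun C hC => hC.1) fun y hy => ?_
    obtain ⟨i, hi⟩ := mem_iUnion.1 (hU.symm ▸ hy : y ∈ ⋃ i, f i)
    exact ⟨f i, (isDefComponent_iff hYo).2 ⟨hsub i, (hf i).2.1, (hf i).2.2.1, (hf i).2.2.2.1,
      (hf i).1, (hf i).2.2.2.2⟩, hi⟩

end Order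

end TTT

theorem theorem4
    (L : FirstOrder.Language) (Mt : Type*) (Mb : Type*) [L.Structure (Mt ⊕ Mb)]
    [TopologicalSpace Mt] (k : ℕ) (φ : L.Formula (Unit ⊕ Fin k))
    (hM : TTT.IsTTT (Mt := Mt) L Mb φ)
    (hdim : TTT.DimEq L Mb 1 (Set.univ : Set Mt))
    (hsat : TTT.IsOmegaSaturated L (Mt ⊕ Mb))
    (hconn : TTT.DefConnected L Mb (Set.univ : Set Mt))
    (hsplit : ∀ x : Mt, 2 ≤ TTT.numComponents L Mb ({x}ᶜ : Set Mt)) :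
    ∃ X : Set Mt, X.Finite ∧
      {C : Set Mt | TTT.IsDefComponent L Mb C Xᶜ}.Finite ∧
      ⋃₀ {C : Set Mt | TTT.IsDefComponent L Mb C Xᶜ} = Xᶜ ∧
      ∀ C : Set Mt, TTT.IsDefComponent L Mb C Xᶜ → TTT.IsOMinimal L Mb C := by
  have := hM.t2
  have := hM.tame hdim hconn
  obtain ⟨E, hE⟩ := TTT.exists_cutRel hsat fun x => TTT.exists_cuts (hsplit x)
  have hT := hE.treeRel
  have hfin := hT.finite_branch
  have ho := hfin.isClosed.isOpen_compl
  obtain ⟨h1, h2⟩ := TTT.finite_and_sUnion_components hT.dfn_branch.compl ho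
  refine ⟨_, hfin, h1, h2, fun C hC => ?_⟩
  obtain ⟨hCY, hCd, hCo, -, hne, hCpc⟩ := (TTT.isDefComponent_iff ho).1 hC
  exact hT.isOMinimal hCo hCpc (Set.subset_compl_iff_disjoint_right.1 hCY) hCd hne
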